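/- For $m\ge 1$ put $\zeta_m=e^{2\pi i/m}\in\mathbb{C}$, and let $\mathbb{Q}(\mu_{2^\infty})\subset\mathbb{C}$ be the field generated by all complex roots of unity of $2$-power order. For a positive integer $a$ and a prime $p$ let $a_p$ denote the largest power of $p$ dividing $a$. For a number field $K\subset\mathbb{C}$ and a prime $\ell$ let $m(K,\ell)$ be the least $m\ge 1$ with $K\cap\mathbb{Q}(\zeta_{\ell^m})=K\cap\mathbb{Q}(\zeta_{\ell^{k}})$ for all $k\ge m$, let $$t(K,\ell)=[\mathbb{Q}(\zeta_{\ell^{m(K,\ell)}}):K\cap\mathbb{Q}(\zeta_{\ell^{m(K,\ell)}})],$$ and for $n \ge 0$ put $$S(n,K)=2^{\,n-\lfloor n/t(K,2)\rfloor}\prod_{\ell}\ell^{\,m(K,\ell)\lfloor n/t(K,\ell)\rfloor}\bigl(\lfloor n/t(K,\ell)\rfloor!\bigr)_\ell ,$$ where $\ell$ runs over all primes (almost all factors are $1$). **Lemma.** Let $K$ be an algebraic number field contained in $\mathbb{Q}(\mu_{2^\infty})$. Then $K$ is Galois over $\mathbb{Q}$ and stable under complex conjugation. If $K\not\subseteq\mathbb{R}$,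 assume that $t(K,2)=1$. Then there are infinitely many nonzero prime ideals $\mathfrak{p}$ of the ring of integers $\mathcal{O}_K$ with $2\notin\mathfrak{p}$ that satisfy both of the following conditions: (i) $\mathfrak{p}$ is stable under complex conjugation; (ii) for every $n\ge 0$ and every non-singular form $\beta$ on $V=\mathbb{F}_q^n$, where $\mathbb{F}_q=\mathcal{O}_K/\mathfrak{p}$, that is hermitian or skew-hermitian with respect to the automorphism $\theta$ of $\mathcal{O}_K/\mathfrak{p}$ induced by complex conjugation, $|\mathrm{Iso}(V,\beta)|_2$ divides $S(n,K)_2$. Here a form $\beta\colon V\times V\to\mathbb{F}_q$ is bi-additive with $\beta(av,bw)=a\,b^{\theta}\beta(v,w)$; it is hermitian (resp. skew-hermitian) if $\beta(w,v)=\beta(v,w)^\theta$ (resp. $\beta(w,v)=-\beta(v,w)^\theta$) for all $v,w \in V$, and non-singular if $\beta(v,V)=\{0\}$ implies $v=0$; and $\mathrm{Iso}(V,\beta)=\{g\in \mathrm{GL}(V)\mid \beta(g(v),g(v'))=\beta(v,v')\text{ for all }v,v' \in V\}$. -/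

import Mathlib

open scoped NumberField ComplexConjugate

/-- The subfield `ℚ(ζ_m)` of `ℂ`, where `ζ_m = e^{2πi/m}`. -/
noncomputable def cyclo (m : ℕ) : IntermediateField ℚ ℂ :=
  IntermediateField.adjoin ℚ {Complex.exp (2 * Real.pi * Complex.I / m)}

/-- The subfield `ℚ(μ_{ℓ^∞})` of `ℂ`, generated by all complex roots of unity of `ℓ`-power order. -/
noncomputable def cycloInf (l : ℕ) : IntermediateField ℚ ℂ :=
  IntermediateField.adjoin ℚ {z : ℂ | ∃ k : ℕ, z ^ (l ^ k) = 1}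

/-- `m(K, ℓ)`: the least `m ≥ 1` such that the chain `K ∩ ℚ(ζ_{ℓ^m})` is constant from `m` on. -/
noncomputable def schurM (K : IntermediateField ℚ ℂ) (l : ℕ) : ℕ :=
  sInf {m : ℕ | 1 ≤ m ∧ ∀ k : ℕ, m ≤ k → K ⊓ cyclo (l ^ m) = K ⊓ cyclo (l ^ k)}

/-- `t(K, ℓ) = [ℚ(ζ_{ℓ^m}) : K ∩ ℚ(ζ_{ℓ^m})]` with `m = m(K, ℓ)`. -/
noncomputable def schurT (K : IntermediateField ℚ ℂ) (l : ℕ) : ℕ :=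
  IntermediateField.relfinrank (K ⊓ cyclo (l ^ schurM K l)) (cyclo (l ^ schurM K l))

/-- The `p`-part of a positive integer `m`: the largest power of `p` dividing `m`. -/
def pPart (p m : ℕ) : ℕ := p ^ padicValNat p m

/-- The Schur bound `S(n, K)`. The product over all primes has only finitely many factors
different from `1`, see `schurS_finite_support`. -/
noncomputable def schurS (n : ℕ) (K : IntermediateField ℚ ℂ) : ℕ :=
  2 ^ (n - n / schurT K 2) *
    ∏ᶠ l : {p : ℕ // p.Prime}, (l : ℕ) ^ (schurM K l * (n / schurT K l)) *
      pPart l (n / schurT K l).factorial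

theorem finrank_cyclo (m : ℕ) (hm : m ≠ 0) : Module.finrank ℚ (cyclo m) = m.totient := by
  have hp := Complex.isPrimitiveRoot_exp m hm
  have hpos := Nat.pos_of_ne_zero hm
  unfold cyclo
  rw [IntermediateField.adjoin.finrank (hp.isIntegral hpos).tower_top,
    ← Polynomial.cyclotomic_eq_minpoly_rat hp hpos, Polynomial.natDegree_cyclotomic]

theorem cyclo_mono {l : ℕ} (hl : l ≠ 0) {a b : ℕ} (hab : a ≤ b) :
    cyclo (l ^ a) ≤ cyclo (l ^ b) := by
  have hb : l ^ b ≠ 0 := pow_ne_zero _ hl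
  have ha : l ^ a ≠ 0 := pow_ne_zero _ hl
  unfold cyclo
  rw [IntermediateField.adjoin_le_iff, Set.singleton_subset_iff, SetLike.mem_coe]
  have h1 : Complex.exp (2 * Real.pi * Complex.I / ((l ^ a : ℕ) : ℂ)) =
      Complex.exp (2 * Real.pi * Complex.I / ((l ^ b : ℕ) : ℂ)) ^ (l ^ (b - a)) := by
    rw [← Complex.exp_nat_mul]
    congr 1
    have hl' : (l : ℂ) ≠ 0 := by exact_mod_cast hl
    obtain ⟨c, rfl⟩ := Nat.exists_eq_add_of_le hab
    simp only [Nat.add_sub_cancel_left, Nat.cast_pow]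
    field_simp
    ring
  rw [h1]
  exact pow_mem (IntermediateField.mem_adjoin_simple_self ℚ _) _

/-- The chain `K ∩ ℚ(ζ_{ℓ^m})` stabilizes, so `m(K, ℓ)` is attained. -/
theorem schurM_spec (K : IntermediateField ℚ ℂ) [FiniteDimensional ℚ K] {l : ℕ} (hl : l ≠ 0) :
    1 ≤ schurM K l ∧
      ∀ k : ℕ, schurM K l ≤ k → K ⊓ cyclo (l ^ schurM K l) = K ⊓ cyclo (l ^ k) := by
  have hne : {m : ℕ | 1 ≤ m ∧
      ∀ k : ℕ, m ≤ k → K ⊓ cyclo (l ^ m) = K ⊓ cyclo (l ^ k)}.Nonempty := by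
    let d : ℕ → ℕ := fun m => Module.finrank ℚ ↥(K ⊓ cyclo (l ^ m))
    have fd : ∀ m, FiniteDimensional ℚ ↥(K ⊓ cyclo (l ^ m)) := fun m =>
      FiniteDimensional.of_injective
        (IntermediateField.inclusion (inf_le_left : K ⊓ cyclo (l ^ m) ≤ K)).toLinearMap
        (IntermediateField.inclusion_injective inf_le_left)
    have hbd : ∀ m, d m ≤ Module.finrank ℚ K := fun m =>
      IntermediateField.finrank_le_of_le_right inf_le_left
    have hm : Set.Nonempty (Set.range fun m => d (m + 1)) := Set.range_nonempty _
    have hB : BddAbove (Set.range fun m => d (m + 1)) := by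
      refine ⟨Module.finrank ℚ K, ?_⟩
      rintro _ ⟨m, rfl⟩
      exact hbd _
    obtain ⟨m, hm'⟩ := Nat.sSup_mem hm hB
    refine ⟨m + 1, Nat.le_add_left 1 m, fun k hk => ?_⟩
    have hle : K ⊓ cyclo (l ^ (m + 1)) ≤ K ⊓ cyclo (l ^ k) :=
      inf_le_inf_left K (cyclo_mono hl hk)
    have := fd k
    refine IntermediateField.eq_of_le_of_finrank_le hle ?_
    have h1 : d (k - 1 + 1) ≤ d (m + 1) := by
      refine le_of_le_of_eq ?_ hm'.symm
      exact le_csSup hB ⟨k - 1, rfl⟩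
    rwa [Nat.sub_add_cancel (by omega)] at h1
  exact Nat.sInf_mem hne

theorem schurT_mul_finrank (K : IntermediateField ℚ ℂ) [FiniteDimensional ℚ K] {l : ℕ}
    (hl : l.Prime) : l - 1 ≤ schurT K l * Module.finrank ℚ K := by
  have hm := (schurM_spec K hl.ne_zero).1
  unfold schurT
  set m := schurM K l
  have h1 : Module.finrank ℚ (cyclo (l ^ m)) = (l ^ m).totient :=
    finrank_cyclo _ (pow_ne_zero _ hl.ne_zero)
  have h2 : Module.finrank ℚ ↥(K ⊓ cyclo (l ^ m)) *
      IntermediateField.relfinrank (K ⊓ cyclo (l ^ m)) (cyclo (l ^ m)) =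
        Module.finrank ℚ (cyclo (l ^ m)) :=
    IntermediateField.finrank_bot_mul_relfinrank inf_le_right
  have h3 : Module.finrank ℚ ↥(K ⊓ cyclo (l ^ m)) ≤ Module.finrank ℚ K :=
    IntermediateField.finrank_le_of_le_right inf_le_left
  have h4 : l - 1 ≤ (l ^ m).totient := by
    rw [Nat.totient_prime_pow hl hm]
    exact Nat.le_mul_of_pos_left _ (pow_pos hl.pos _)
  calc l - 1 ≤ _ := h4
    _ = _ := by rw [← h1, ← h2]
    _ ≤ Module.finrank ℚ K *
      IntermediateField.relfinrank (K ⊓ cyclo (l ^ m)) (cyclo (l ^ m)) :=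
        Nat.mul_le_mul_right _ h3
    _ = _ := mul_comm _ _

/-- Almost all factors in the product defining `S(n, K)` are equal to `1`. -/
theorem schurS_finite_support (n : ℕ) (K : IntermediateField ℚ ℂ) [FiniteDimensional ℚ K] :
    (Function.mulSupport fun l : {p : ℕ // p.Prime} =>
      (l : ℕ) ^ (schurM K l * (n / schurT K l)) * pPart l (n / schurT K l).factorial).Finite := by
  refine Set.Finite.subset (Set.Finite.preimage (Subtype.val_injective.injOn)
    (Set.finite_Iic (n * Module.finrank ℚ K + 1))) (fun l hl => ?_)
  by_contra hlt
  simp only [Set.mem_preimage, Set.mem_Iic, not_le] at hlt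
  refine hl ?_
  have h1 := schurT_mul_finrank K l.2
  have h2 : n < schurT K l := by
    by_contra hle
    have := Nat.mul_le_mul_right (Module.finrank ℚ K) (not_lt.mp hle)
    have hv : n * Module.finrank ℚ K + 1 < (l : ℕ) := hlt
    change (l : ℕ) - 1 ≤ _ at h1
    omega
  simp [Nat.div_eq_of_lt h2, pPart]

/-- Complex conjugation as an automorphism of a conjugation-stable subfield `K` of `ℂ`. -/
noncomputable def conjField (K : IntermediateField ℚ ℂ) (hK : ∀ x ∈ K, conj x ∈ K) : K ≃+* K where
  toFun x := ⟨starRingEnd ℂ (x : ℂ), hK x x.2⟩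
  invFun x := ⟨starRingEnd ℂ (x : ℂ), hK x x.2⟩
  left_inv x := Subtype.ext (Complex.conj_conj (x : ℂ))
  right_inv x := Subtype.ext (Complex.conj_conj (x : ℂ))
  map_mul' x y := Subtype.ext (map_mul (starRingEnd ℂ) (x : ℂ) (y : ℂ))
  map_add' x y := Subtype.ext (map_add (starRingEnd ℂ) (x : ℂ) (y : ℂ))

/-- Complex conjugation as an automorphism of the ring of integers of `K`. -/
noncomputable def conjInt (K : IntermediateField ℚ ℂ) (hK : ∀ x ∈ K, conj x ∈ K) : 𝓞 K ≃+* 𝓞 K :=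
  NumberField.RingOfIntegers.mapRingEquiv (conjField K hK)

theorem coe_conjInt (K : IntermediateField ℚ ℂ) (hK : ∀ x ∈ K, conj x ∈ K) (x : 𝓞 K) :
    (((conjInt K hK x : 𝓞 K) : K) : ℂ) = conj ((x : K) : ℂ) := rfl

/-- The isometry group of a form `β` that is linear in the first and `θ`-semilinear in the
second variable. -/
def isoGroup {k V : Type*} [CommRing k] [AddCommGroup V] [Module k V] {θ : k →+* k}
    (β : V →ₗ[k] V →ₛₗ[θ] k) : Subgroup (V ≃ₗ[k] V) where
  carrier := {g | ∀ v w, β (g v) (g w) = β v w}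
  mul_mem' {a b} ha hb v w := (ha (b v) (b w)).trans (hb v w)
  one_mem' _ _ := rfl
  inv_mem' {a} ha v w := by
    have h := ha (a⁻¹ v) (a⁻¹ w)
    have e : ∀ u, a (a⁻¹ u) = u := fun u => a.apply_symm_apply u
    rw [e, e] at h
    exact h.symm

/-- `β` is hermitian: `β(w, v) = β(v, w)^θ`. -/
def IsHermitianForm {k V : Type*} [CommRing k] [AddCommGroup V] [Module k V] {θ : k →+* k}
    (β : V →ₗ[k] V →ₛₗ[θ] k) : Prop := ∀ v w, β w v = θ (β v w)

/-- `β` is skew-hermitian: `β(w, v) = -β(v, w)^θ`. -/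
def IsSkewHermitianForm {k V : Type*} [CommRing k] [AddCommGroup V] [Module k V] {θ : k →+* k}
    (β : V →ₗ[k] V →ₛₗ[θ] k) : Prop := ∀ v w, β w v = -θ (β v w)

/-- The automorphism of `R ⧸ 𝔭` induced by an automorphism `c` of `R` with `c(𝔭) = 𝔭`. -/
def residueAut {R : Type*} [CommRing R] (c : R ≃+* R) (𝔭 : Ideal R)
    (h : 𝔭 = 𝔭.map (c : R →+* R)) : R ⧸ 𝔭 →+* R ⧸ 𝔭 :=
  (Ideal.quotientEquiv 𝔭 𝔭 c h : R ⧸ 𝔭 ≃+* R ⧸ 𝔭)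

/-! Choose `M ≥ 2` with `K ⊆ ℚ(ζ_{2^M})`: `M = m(K,2)`, except that `M = 2` when `m(K,2) = 1`.
Dirichlet gives infinitely many primes `p` with `v₂(p + 1) = M` exactly. As `p ≡ -1` mod `2^M`,
complex conjugation is the Frobenius at `p`, that is, `conj x ≡ x^p` mod `p` on `𝓞 K`. So any prime
`𝔭` above `p` is stable and `θ` is `x ↦ x^p`. If `K` is real, then `θ = 1`, the residue field is
`𝔽_p`, and the groups are orthogonal or symplectic. Otherwise `i ∈ K`, `θ` moves `i`, the residue
field is `𝔽_{p²}`, and all groups are unitary, since a skew-hermitian form is a scalar multiple of a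
hermitian one.

The 2-parts are bounded by induction on the dimension. The group acts on the vectors of a fixed
nonzero length (on hyperbolic pairs in the symplectic case). Some orbit has 2-adic valuation at most
that of the whole set, and the stabilizer embeds in the isometry group of the orthogonal complement;
transitivity is not needed. The sets are counted explicitly (`exists_hasCounts`,
`padicValNat_card_hyperbolicPairs`, `mul_vecCount_hermitian`), and lifting the exponent evaluates
the factors `q^j ± 1`.

The resulting bounds are `n - ⌊n/2⌋ + M⌊n/2⌋ + v₂(⌊n/2⌋!)` and, in the unitary case, `Mn + v₂(n!)`.
They match `S(n,K)` because `t(K,2)` is 1 by hypothesis for non-real `K`, and 2 for real `K` with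
`m(K,2) ≥ 2` (`schurT_of_real`). The latter holds because the Galois group of `ℚ(ζ_{2^m})` over `K`
contains `-1` but, by minimality of `m`, not `1 + 2^(m-1)`, which forces it to be `{±1}`. -/

section Orbits

/-- A group acting on a nonempty finite set has an orbit whose length has `p`-adic valuation
at most that of the set. -/
theorem exists_padicValNat_card_le_stabilizer {G Y : Type*} [Group G] [Finite G] [MulAction G Y]
    (p : ℕ) [Fact p.Prime] (X : Set Y) (hfin : X.Finite) (hne : X.Nonempty)
    (hX : ∀ g : G, ∀ x ∈ X, g • x ∈ X) :
    ∃ x ∈ X, padicValNat p (Nat.card G) ≤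
      padicValNat p (Nat.card X) + padicValNat p (Nat.card (MulAction.stabilizer G x)) := by
  classical
  let S : SubMulAction G Y := ⟨X, fun g {x} hx => hX g x hx⟩
  have : Finite S := hfin
  have : Nonempty S := hne.to_subtype
  by_contra! h
  set s := padicValNat p (Nat.card X) with hs
  have hcard : Nat.card X ≠ 0 := by
    have : Nat.card S ≠ 0 := Nat.card_pos.ne'
    exact this
  -- If the claim failed at every point, each orbit length, and hence the size of the set, would be
  -- divisible by `p^(s+1)`.
  have key : ∀ x : S, p ^ (s + 1) ∣ Nat.card (MulAction.orbit G x) := by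
    intro x
    have h1 := h x x.2
    have h2 : Nat.card (MulAction.orbit G x) * Nat.card (MulAction.stabilizer G (x : Y)) =
        Nat.card G := by
      rw [← SubMulAction.stabilizer_of_subMul x, ← Nat.card_prod]
      exact Nat.card_congr (MulAction.orbitProdStabilizerEquivGroup G x)
    have ho : Nat.card (MulAction.orbit G x) ≠ 0 := by
      intro h0
      rw [h0, zero_mul] at h2
      exact Nat.card_pos.ne h2
    have hst : Nat.card (MulAction.stabilizer G (x : Y)) ≠ 0 := Nat.card_pos.ne'
    rw [← h2, padicValNat.mul ho hst] at h1
    exact (padicValNat_dvd_iff_le ho).2 (by omega)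
  have hdvd : p ^ (s + 1) ∣ Nat.card S := by
    have := Fintype.ofFinite (MulAction.orbitRel.Quotient G S)
    rw [Nat.card_congr (MulAction.selfEquivSigmaOrbits G S), Nat.card_sigma]
    exact Finset.dvd_sum fun ω _ => key _
  have := (padicValNat_dvd_iff_le hcard).1 hdvd
  omega

end Orbits

/-! ### Sesquilinear forms: orthogonal complements, splittings and vector counts. -/

section Forms

variable {k V : Type*} [Field k] [AddCommGroup V] [Module k V] {θ : k →+* k}

/-- The left orthogonal complement of a set with respect to a sesquilinear form. -/
def leftPerp (β : V →ₗ[k] V →ₛₗ[θ] k) (S : Set V) : Submodule k V where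
  carrier := {w | ∀ u ∈ S, β w u = 0}
  add_mem' ha hb u hu := by simp [ha u hu, hb u hu]
  zero_mem' u _ := by simp
  smul_mem' c x hx u hu := by simp [hx u hu]

theorem mem_leftPerp {β : V →ₗ[k] V →ₛₗ[θ] k} {S : Set V} {w : V} :
    w ∈ leftPerp β S ↔ ∀ u ∈ S, β w u = 0 := Iff.rfl

/-- The restriction of a sesquilinear form to a subspace. -/
def restrictForm (β : V →ₗ[k] V →ₛₗ[θ] k) (W : Submodule k V) : W →ₗ[k] W →ₛₗ[θ] k :=
  β.domRestrict₁₂ W W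

@[simp]
theorem restrictForm_apply (β : V →ₗ[k] V →ₛₗ[θ] k) (W : Submodule k V) (v w : W) :
    restrictForm β W v w = β v w := rfl

theorem IsHermitianForm.restrict {β : V →ₗ[k] V →ₛₗ[θ] k} (h : IsHermitianForm β)
    (W : Submodule k V) : IsHermitianForm (restrictForm β W) := fun v w => h v w

theorem IsHermitianForm.isRefl {β : V →ₗ[k] V →ₛₗ[θ] k} (h : IsHermitianForm β) (v w : V)
    (hvw : β v w = 0) : β w v = 0 := by rw [h v w, hvw, map_zero]

theorem apply_eq_zero_of_mem_leftPerp_of_mem_span {β : V →ₗ[k] V →ₛₗ[θ] k} {S : Set V}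
    {w u : V} (hw : w ∈ leftPerp β S) (hu : u ∈ Submodule.span k S) : β w u = 0 := by
  induction hu using Submodule.span_induction with
  | mem x hx => exact hw x hx
  | zero => simp
  | add x y _ _ hx hy => simp [hx, hy]
  | smul a x _ hx => simp [hx]

/-- The hypothesis says that `V` is the span of `S` plus its complement, so a vector of the
complement orthogonal to the complement is orthogonal to everything. A set `S` is allowed so that
both an anisotropic vector and a hyperbolic pair are covered. -/
theorem separatingLeft_restrictForm_leftPerp {β : V →ₗ[k] V →ₛₗ[θ] k} (hβ : β.SeparatingLeft)
    {S : Set V} (hS : ∀ x, ∃ u ∈ Submodule.span k S, x - u ∈ leftPerp β S) :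
    (restrictForm β (leftPerp β S)).SeparatingLeft := by
  intro w hw
  refine Subtype.ext (hβ w fun x => ?_)
  obtain ⟨u, hu, hx⟩ := hS x
  have h1 : β w (x - u) = 0 := hw ⟨x - u, hx⟩
  have h2 := apply_eq_zero_of_mem_leftPerp_of_mem_span w.2 hu
  rw [← sub_add_cancel x u, map_add, h1, h2, add_zero]

theorem map_mem_leftPerp {β : V →ₗ[k] V →ₛₗ[θ] k} {S : Set V} {g : V ≃ₗ[k] V}
    (hg : g ∈ isoGroup β) (hS : ∀ u ∈ S, g u = u) {w : V} (hw : w ∈ leftPerp β S) :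
    g w ∈ leftPerp β S := by
  intro u hu
  rw [← hS u hu, hg w u]
  exact hw u hu

/-- A subgroup of the isometry group fixing a set `S` pointwise acts on the orthogonal
complement of `S`. -/
def restrictIso (β : V →ₗ[k] V →ₛₗ[θ] k) (S : Set V) (H : Subgroup (isoGroup β))
    (hH : ∀ g ∈ H, ∀ u ∈ S, (g : V ≃ₗ[k] V) u = u) :
    H →* isoGroup (restrictForm β (leftPerp β S)) where
  toFun g := ⟨LinearEquiv.ofLinearMap
      (((g : isoGroup β) : V ≃ₗ[k] V).toLinearMap.restrict
        fun _ hw => map_mem_leftPerp (g : isoGroup β).2 (hH g g.2) hw)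
      (((g⁻¹ : H) : isoGroup β).1.toLinearMap.restrict
        fun _ hw => map_mem_leftPerp ((g⁻¹ : H) : isoGroup β).2 (hH _ (g⁻¹ : H).2) hw)
      (LinearMap.ext fun w => Subtype.ext (LinearEquiv.apply_symm_apply (g : isoGroup β).1 w.1))
      (LinearMap.ext fun w => Subtype.ext (LinearEquiv.symm_apply_apply (g : isoGroup β).1 w.1)),
    fun v w => (g : isoGroup β).2 v w⟩
  map_one' := rfl
  map_mul' _ _ := rfl

/-- The action on the complement is faithful: elements of `H` fix the span of `S`, and this span
together with the complement generates `V`. -/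
theorem card_dvd_card_isoGroup_leftPerp (β : V →ₗ[k] V →ₛₗ[θ] k) {S : Set V}
    (hS : ∀ x, ∃ u ∈ Submodule.span k S, x - u ∈ leftPerp β S) (H : Subgroup (isoGroup β))
    (hH : ∀ g ∈ H, ∀ u ∈ S, (g : V ≃ₗ[k] V) u = u) :
    Nat.card H ∣ Nat.card (isoGroup (restrictForm β (leftPerp β S))) := by
  refine Subgroup.card_dvd_of_injective (restrictIso β S H hH) fun g h hgh => ?_
  refine Subtype.ext (Subtype.ext (LinearEquiv.ext fun x => ?_))
  obtain ⟨u, hu, hx⟩ := hS x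
  have h1 : ∀ g ∈ H, (g : V ≃ₗ[k] V) u = u := by
    intro g hg
    have : Submodule.span k S ≤ LinearMap.eqLocus (g : V ≃ₗ[k] V).toLinearMap LinearMap.id :=
      Submodule.span_le.2 fun y hy => hH g hg y hy
    exact this hu
  have h2 : ((g : isoGroup β) : V ≃ₗ[k] V) (x - u) = ((h : isoGroup β) : V ≃ₗ[k] V) (x - u) := by
    have := congrArg (fun f => (((f : isoGroup (restrictForm β (leftPerp β S))) :
      leftPerp β S ≃ₗ[k] leftPerp β S) ⟨x - u, hx⟩ : V)) hgh
    exact this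
  rw [map_sub, map_sub, h1 g g.2, h1 h h.2] at h2
  exact sub_left_injective h2

/-- Orthogonal projection away from an anisotropic vector. -/
theorem exists_span_singleton_sub_mem_leftPerp {β : V →ₗ[k] V →ₛₗ[θ] k} {v : V}
    (hv : β v v ≠ 0) (x : V) :
    ∃ u ∈ Submodule.span k {v}, x - u ∈ leftPerp β {v} := by
  refine ⟨(β x v / β v v) • v, Submodule.smul_mem _ _ (Submodule.mem_span_singleton_self v), ?_⟩
  rintro _ rfl
  simp [div_mul_cancel₀ _ hv]

/-- The splitting of a hermitian space by an anisotropic vector. -/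
def splitAnisotropic (β : V →ₗ[k] V →ₛₗ[θ] k) (v : V) (hv : β v v ≠ 0) :
    (k × leftPerp β {v}) ≃ₗ[k] V where
  toFun x := x.1 • v + x.2
  map_add' x y := by simp [add_smul]; abel
  map_smul' c x := by simp [mul_smul]
  invFun x := (β x v / β v v, ⟨x - (β x v / β v v) • v, by
    rintro _ rfl
    simp [div_mul_cancel₀ _ hv]⟩)
  left_inv x := by
    have h : β (x.2 : V) v = 0 := x.2.2 v rfl
    ext <;> simp [h, hv]
  right_inv x := by simp

theorem finrank_leftPerp_singleton [FiniteDimensional k V] {β : V →ₗ[k] V →ₛₗ[θ] k} {v : V}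
    (hv : β v v ≠ 0) : Module.finrank k (leftPerp β {v}) + 1 = Module.finrank k V := by
  rw [← (splitAnisotropic β v hv).finrank_eq, Module.finrank_prod, Module.finrank_self, add_comm]

theorem apply_splitAnisotropic {β : V →ₗ[k] V →ₛₗ[θ] k} (hβ : IsHermitianForm β) {v : V}
    (hv : β v v ≠ 0) (x : k × leftPerp β {v}) :
    β (splitAnisotropic β v hv x) (splitAnisotropic β v hv x) =
      x.1 * θ x.1 * β v v + restrictForm β (leftPerp β {v}) x.2 x.2 := by
  have h : β (x.2 : V) v = 0 := x.2.2 v rfl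
  have h' : β v (x.2 : V) = 0 := hβ.isRefl _ _ h
  simp [splitAnisotropic, h, h', mul_assoc]

/-- If all lengths vanish, scale `v` so that `β(v,w) = 1`; then `β(w,v) = 1` as well and `v + w` has
length `2 ≠ 0`. -/
theorem exists_anisotropic {β : V →ₗ[k] V →ₛₗ[θ] k} (h2 : (2 : k) ≠ 0)
    (hβ : IsHermitianForm β) (hs : β.SeparatingLeft) [Nontrivial V] : ∃ v, β v v ≠ 0 := by
  by_contra! h
  obtain ⟨v, hv⟩ := exists_ne (0 : V)
  have : ∃ w, β v w ≠ 0 := by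
    by_contra! h0
    exact hv (hs v h0)
  obtain ⟨w, hw⟩ := this
  have h1 := h ((β v w)⁻¹ • v + w)
  have h3 : β w v = θ (β v w) := hβ v w
  have h4 : θ (β v w) ≠ 0 := by simpa using hw
  simp [h v, h w, h3, hw, h4] at h1
  apply h2
  linear_combination h1

/-- The number of vectors of given length. -/
noncomputable def vecCount (β : V →ₗ[k] V →ₛₗ[θ] k) (a : k) : ℕ :=
  Nat.card {v : V // β v v = a}

/-- The isometry group is bounded `p`-adically by the vectors of a given length and the isometry
group of the orthogonal complement of one of them. -/
theorem exists_padicValNat_isoGroup_le [Finite V] (p : ℕ) [Fact p.Prime]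
    (β : V →ₗ[k] V →ₛₗ[θ] k) {a : k} (ha : a ≠ 0) (hne : ∃ v, β v v = a) :
    ∃ v, β v v = a ∧ padicValNat p (Nat.card (isoGroup β)) ≤ padicValNat p (vecCount β a) +
      padicValNat p (Nat.card (isoGroup (restrictForm β (leftPerp β {v})))) := by
  have hfin : Finite (V ≃ₗ[k] V) := Finite.of_injective (fun g => (g : V → V)) DFunLike.coe_injective
  obtain ⟨v, hv, h⟩ := exists_padicValNat_card_le_stabilizer (G := isoGroup β) p {v | β v v = a}
    (Set.toFinite _) hne (fun g x hx => (g.2 x x).trans hx)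
  refine ⟨v, hv, h.trans (Nat.add_le_add_left ?_ _)⟩
  have hv0 : β v v ≠ 0 := by rw [show β v v = a from hv]; exact ha
  have hfin' : Finite (leftPerp β {v} ≃ₗ[k] leftPerp β {v}) :=
    Finite.of_injective (fun g => (g : _ → _)) DFunLike.coe_injective
  refine (padicValNat_dvd_iff_le Nat.card_pos.ne').1 (pow_padicValNat_dvd.trans ?_)
  refine card_dvd_card_isoGroup_leftPerp β (exists_span_singleton_sub_mem_leftPerp hv0) _ ?_
  rintro g hg _ rfl
  exact hg

theorem vecCount_pos_of_eq [Finite V] {β : V →ₗ[k] V →ₛₗ[θ] k} {a : k} (v : V) (hv : β v v = a) :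
    0 < vecCount β a :=
  have : Nonempty {v : V // β v v = a} := ⟨⟨v, hv⟩⟩
  Nat.card_pos

/-- Counting vectors of given length after splitting off an anisotropic vector. -/
theorem vecCount_eq_sum [Fintype k] [Finite V] {β : V →ₗ[k] V →ₛₗ[θ] k} (hβ : IsHermitianForm β)
    {v : V} (hv : β v v ≠ 0) (a : k) :
    vecCount β a = ∑ x : k, vecCount (restrictForm β (leftPerp β {v})) (a - x * θ x * β v v) := by
  unfold vecCount
  rw [← Nat.card_sigma]
  refine Nat.card_congr (((splitAnisotropic β v hv).toEquiv.subtypeEquiv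
    (p := fun x => x.1 * θ x.1 * β v v + restrictForm β (leftPerp β {v}) x.2 x.2 = a)
    fun x => ?_).symm.trans
    ⟨fun x => ⟨x.1.1, x.1.2, eq_sub_of_add_eq' x.2⟩,
      fun x => ⟨(x.1, x.2.1), add_eq_of_eq_sub' x.2.2⟩, fun _ => rfl, fun _ => rfl⟩)
  rw [← apply_splitAnisotropic hβ hv]
  rfl

theorem sum_vecCount [Fintype k] [Finite V] (β : V →ₗ[k] V →ₛₗ[θ] k) :
    ∑ a, vecCount β a = Nat.card V := by
  unfold vecCount
  rw [← Nat.card_sigma]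
  exact Nat.card_congr (Equiv.sigmaFiberEquiv fun v => β v v)

end Forms

universe u

/-! ### Vector counts for symmetric forms in odd characteristic. -/

section Symmetric

theorem natCard_eq_pow_of_finrank {k V : Type*} [Field k] [Fintype k] [AddCommGroup V] [Module k V]
    [Finite V] {n : ℕ} (h : Module.finrank k V = n) : Nat.card V = Fintype.card k ^ n := by
  rw [Module.natCard_eq_pow_finrank (K := k), h, Nat.card_eq_fintype_card]

theorem ringChar_ne_two_of_two_ne_zero {k : Type*} [Field k] (h2 : (2 : k) ≠ 0) :
    ringChar k ≠ 2 := fun h => h2 <| by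
  have := ringChar.Nat.cast_ringChar (R := k)
  rw [h] at this
  exact_mod_cast this

variable {k : Type*} [Field k] [Fintype k] [DecidableEq k]

/-- A Jacobi sum for the quadratic character. -/
theorem sum_quadraticChar_mul_sub (h2 : (2 : k) ≠ 0) (a : k) :
    ∑ c, quadraticChar k c * quadraticChar k (a - c) =
      quadraticChar k (-1) * ((if a = 0 then (Fintype.card k : ℤ) else 0) - 1) := by
  have hχ : quadraticChar k ≠ 1 := quadraticChar_ne_one (ringChar_ne_two_of_two_ne_zero h2)
  split_ifs with ha
  · subst ha
    have h : ∀ c : k, quadraticChar k c * quadraticChar k (0 - c) =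
        quadraticChar k (-1) * (if c = 0 then 0 else 1) := by
      intro c
      rw [zero_sub, ← neg_one_mul c, map_mul, mul_left_comm, ← sq]
      split_ifs with hc
      · simp [hc]
      · rw [quadraticChar_sq_one hc]
    simp_rw [h]
    rw [← Finset.mul_sum, Finset.sum_ite, Finset.sum_const_zero, zero_add, Finset.sum_const,
      Finset.filter_ne', Finset.card_erase_of_mem (Finset.mem_univ _), Finset.card_univ]
    simp [Nat.cast_sub Fintype.card_pos]
  · have hJ := jacobiSum_nontrivial_inv hχ
    rw [(quadraticChar_isQuadratic k).inv, jacobiSum] at hJ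
    rw [← Equiv.sum_comp (Equiv.mulLeft₀ a ha)]
    have h : ∀ c : k, quadraticChar k (Equiv.mulLeft₀ a ha c) *
        quadraticChar k (a - Equiv.mulLeft₀ a ha c) =
        quadraticChar k c * quadraticChar k (1 - c) := by
      intro c
      have : a - a * c = a * (1 - c) := by ring
      change quadraticChar k (a * c) * quadraticChar k (a - a * c) = _
      rw [this, map_mul, map_mul]
      linear_combination (quadraticChar k c * quadraticChar k (1 - c)) * quadraticChar_sq_one ha
    simp_rw [h, hJ]
    ring

theorem card_mul_sq_eq (h2 : (2 : k) ≠ 0) {b : k} (hb : b ≠ 0) (c : k) :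
    ((Finset.univ.filter fun x : k => x * x * b = c).card : ℤ) =
      1 + quadraticChar k b * quadraticChar k c := by
  have h := quadraticChar_card_sqrts (ringChar_ne_two_of_two_ne_zero h2) (b⁻¹ * c)
  have h3 : quadraticChar k b⁻¹ = quadraticChar k b := by
    have := quadraticChar_sq_one hb
    have h4 : quadraticChar k b⁻¹ * quadraticChar k b = 1 := by
      rw [← map_mul, inv_mul_cancel₀ hb, map_one]
    linear_combination quadraticChar k b * h4 - quadraticChar k b⁻¹ * this
  rw [map_mul, h3, add_comm] at h
  rw [← h]
  congr 2
  ext x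
  simp only [Finset.mem_filter, Finset.mem_univ, true_and, Set.mem_toFinset, Set.mem_ofPred_eq]
  rw [eq_inv_mul_iff_mul_eq₀ hb]
  constructor <;> intro h <;> rw [← h] <;> ring

variable {V : Type*} [AddCommGroup V] [Module k V] {θ : k →+* k}

/-- Group the scalars `x` by `c = x² β(v,v)`. Each fibre has `1 + χ(β(v,v)) χ(c)` elements; the
constant 1 counts the whole complement and the character gives the twisted sum. -/
theorem vecCount_eq_sum_quadraticChar [Finite V] (h2 : (2 : k) ≠ 0) (hθ : ∀ x, θ x = x)
    {β : V →ₗ[k] V →ₛₗ[θ] k} (hβ : IsHermitianForm β) {v : V} (hv : β v v ≠ 0) (a : k) :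
    (vecCount β a : ℤ) = Nat.card (leftPerp β {v}) + quadraticChar k (β v v) *
      ∑ c, quadraticChar k c * vecCount (restrictForm β (leftPerp β {v})) (a - c) := by
  rw [vecCount_eq_sum hβ hv a, ← sum_vecCount (restrictForm β (leftPerp β {v}))]
  simp_rw [hθ]
  rw [← Finset.sum_fiberwise' Finset.univ (fun x : k => x * x * β v v)
    fun c => vecCount (restrictForm β (leftPerp β {v})) (a - c)]
  simp_rw [Finset.sum_const, smul_eq_mul]
  push_cast
  simp_rw [card_mul_sq_eq h2 hv, add_mul, one_mul]
  rw [Finset.sum_add_distrib, Finset.mul_sum]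
  congr 1
  · exact Fintype.sum_equiv (Equiv.subLeft a) _ _ fun c => rfl
  · simp_rw [mul_assoc]

/-- The vector counts of a nondegenerate symmetric form of dimension `2 d` and sign `ε`. -/
def HasEvenCounts (β : V →ₗ[k] V →ₛₗ[θ] k) (d : ℕ) (ε : ℤ) : Prop :=
  ∀ a, (Fintype.card k : ℤ) * vecCount β a = (Fintype.card k : ℤ) ^ (2 * d) +
    ε * ((if a = 0 then (Fintype.card k : ℤ) ^ (d + 1) else 0) - (Fintype.card k : ℤ) ^ d)

/-- The vector counts of a nondegenerate symmetric form of dimension `2 d + 1` and sign `ε`. -/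
def HasOddCounts (β : V →ₗ[k] V →ₛₗ[θ] k) (d : ℕ) (ε : ℤ) : Prop :=
  ∀ a, (vecCount β a : ℤ) = (Fintype.card k : ℤ) ^ (2 * d) +
    ε * (Fintype.card k : ℤ) ^ d * quadraticChar k a

/-- In even dimension the count depends only on whether the length is zero. The constant part is
killed by `∑ χ = 0`, and only `c = a` survives in the twisted sum. -/
theorem HasEvenCounts.odd [Finite V] (h2 : (2 : k) ≠ 0) (hθ : ∀ x, θ x = x)
    {β : V →ₗ[k] V →ₛₗ[θ] k} (hβ : IsHermitianForm β) {v : V} (hv : β v v ≠ 0) {d : ℕ} {ε : ℤ}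
    (hd : Module.finrank k (leftPerp β {v}) = 2 * d)
    (h : HasEvenCounts (restrictForm β (leftPerp β {v})) d ε) :
    HasOddCounts β d (ε * quadraticChar k (β v v)) := by
  intro a
  have hχ := quadraticChar_sum_zero (ringChar_ne_two_of_two_ne_zero h2)
  have hq : (Fintype.card k : ℤ) ≠ 0 := by simp
  apply mul_left_cancel₀ hq
  rw [vecCount_eq_sum_quadraticChar h2 hθ hβ hv a, natCard_eq_pow_of_finrank hd, mul_add,
    mul_left_comm _ (quadraticChar k _), Finset.mul_sum]
  have h1 : ∀ c : k, (Fintype.card k : ℤ) * (quadraticChar k c *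
      vecCount (restrictForm β (leftPerp β {v})) (a - c)) =
      quadraticChar k c * ((Fintype.card k : ℤ) ^ (2 * d) - ε * (Fintype.card k : ℤ) ^ d) +
      if a = c then ε * (Fintype.card k : ℤ) ^ (d + 1) * quadraticChar k a else 0 := by
    intro c
    rw [mul_left_comm, h (a - c)]
    simp only [sub_eq_zero]
    split_ifs with hc
    · rw [hc]; ring
    · ring
  simp_rw [h1]
  rw [Finset.sum_add_distrib, ← Finset.sum_mul, hχ, Finset.sum_ite_eq]
  simp
  ring

/-- Here the twisted sum becomes the Jacobi sum `∑ χ(c) χ(a - c)`, which is where `χ(-1)` and the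
case distinction at `a = 0` come from. -/
theorem HasOddCounts.even [Finite V] (h2 : (2 : k) ≠ 0) (hθ : ∀ x, θ x = x)
    {β : V →ₗ[k] V →ₛₗ[θ] k} (hβ : IsHermitianForm β) {v : V} (hv : β v v ≠ 0) {d : ℕ} {ε : ℤ}
    (hd : Module.finrank k (leftPerp β {v}) = 2 * d + 1)
    (h : HasOddCounts (restrictForm β (leftPerp β {v})) d ε) :
    HasEvenCounts β (d + 1) (ε * quadraticChar k (β v v) * quadraticChar k (-1)) := by
  intro a
  have hχ := quadraticChar_sum_zero (ringChar_ne_two_of_two_ne_zero h2)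
  rw [vecCount_eq_sum_quadraticChar h2 hθ hβ hv a, natCard_eq_pow_of_finrank hd]
  have h1 : ∀ c : k, (quadraticChar k c *
      vecCount (restrictForm β (leftPerp β {v})) (a - c)) =
      quadraticChar k c * (Fintype.card k : ℤ) ^ (2 * d) +
      ε * (Fintype.card k : ℤ) ^ d * (quadraticChar k c * quadraticChar k (a - c)) := by
    intro c
    rw [h (a - c)]
    ring
  simp_rw [h1]
  rw [Finset.sum_add_distrib, ← Finset.sum_mul, hχ, ← Finset.mul_sum,
    sum_quadraticChar_mul_sub h2]
  push_cast
  split_ifs <;> ring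

/-- The even counts are stated after multiplication by `q`, so that `q^(d-1)` does not occur and the
induction can start at `d = 0`. -/
theorem hasEvenCounts_zero [Subsingleton V] (β : V →ₗ[k] V →ₛₗ[θ] k) :
    HasEvenCounts β 0 1 := by
  intro a
  have h : vecCount β a = if a = 0 then 1 else 0 := by
    unfold vecCount
    split_ifs with ha
    · have : Unique {v : V // β v v = a} :=
        ⟨⟨0, by simp [ha]⟩, fun _ => Subtype.ext (Subsingleton.elim _ _)⟩
      exact Nat.card_unique
    · have : IsEmpty {v : V // β v v = a} :=
        ⟨fun v => ha (by rw [← v.2, Subsingleton.elim (v : V) 0]; simp)⟩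
      exact Nat.card_of_isEmpty
  rw [h]
  split_ifs <;> simp

/-- Splitting off anisotropic vectors alternates the two parities. The sign is not tied to the
discriminant: later arguments need only that it is `±1`. -/
theorem exists_hasCounts (h2 : (2 : k) ≠ 0) (hθ : ∀ x, θ x = x) (n : ℕ) :
    ∀ {V : Type u} [AddCommGroup V] [Module k V] [Finite V] (β : V →ₗ[k] V →ₛₗ[θ] k),
      IsHermitianForm β → β.SeparatingLeft → Module.finrank k V = n →
      (∀ d, n = 2 * d → ∃ ε : ℤ, (ε = 1 ∨ ε = -1) ∧ HasEvenCounts β d ε) ∧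
      (∀ d, n = 2 * d + 1 → ∃ ε : ℤ, (ε = 1 ∨ ε = -1) ∧ HasOddCounts β d ε) := by
  have hsgn : ∀ {x y : ℤ}, (x = 1 ∨ x = -1) → (y = 1 ∨ y = -1) → (x * y = 1 ∨ x * y = -1) := by
    rintro x y (rfl | rfl) (rfl | rfl) <;> simp
  induction n with
  | zero =>
    intro V _ _ _ β hβ hs hn
    have : Subsingleton V := Module.finrank_zero_iff.1 hn
    refine ⟨fun d hd => ?_, fun d hd => by omega⟩
    obtain rfl : d = 0 := by omega
    exact ⟨1, Or.inl rfl, hasEvenCounts_zero β⟩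
  | succ n ih =>
    intro V _ _ _ β hβ hs hn
    have : Nontrivial V := Module.nontrivial_of_finrank_pos (R := k) (by omega)
    obtain ⟨v, hv⟩ := exists_anisotropic h2 hβ hs
    have hW : Module.finrank k (leftPerp β {v}) = n := by
      have := finrank_leftPerp_singleton hv
      omega
    obtain ⟨he, ho⟩ := ih (restrictForm β (leftPerp β {v})) (hβ.restrict _)
      (separatingLeft_restrictForm_leftPerp hs (exists_span_singleton_sub_mem_leftPerp hv)) hW
    refine ⟨fun d hd => ?_, fun d hd => ?_⟩
    · obtain ⟨e, rfl⟩ : ∃ e, d = e + 1 := ⟨d - 1, by omega⟩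
      obtain ⟨ε, hε, h⟩ := ho e (by omega)
      exact ⟨_, hsgn (hsgn hε (quadraticChar_dichotomy hv))
        (quadraticChar_dichotomy (neg_ne_zero.2 one_ne_zero)),
        h.even h2 hθ hβ hv (by omega)⟩
    · obtain ⟨ε, hε, h⟩ := he d (by omega)
      exact ⟨_, hsgn hε (quadraticChar_dichotomy hv), h.odd h2 hθ hβ hv (by omega)⟩

end Symmetric

/-! ### 2-adic valuations of `q^j ± 1` for `q ≡ 3` mod 4. -/

section TwoAdic

theorem mod_four_eq_three {q m : ℕ} (hm : 2 ≤ m) (hq : padicValNat 2 (q + 1) = m) : q % 4 = 3 := by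
  have h : 2 ^ 2 ∣ q + 1 := (pow_dvd_pow 2 (hq ▸ hm)).trans pow_padicValNat_dvd
  omega

theorem padicValNat_two_of_mod_four {a : ℕ} (h : a % 4 = 2) : padicValNat 2 a = 1 := by
  obtain ⟨b, rfl⟩ : 2 ∣ a := by omega
  rw [padicValNat.mul (by norm_num) (by omega), padicValNat_self,
    padicValNat.eq_zero_of_not_dvd (by omega)]

theorem padicValInt_two_eq_zero {a : ℤ} (h : Odd a) : padicValInt 2 a = 0 :=
  padicValNat.eq_zero_of_not_dvd fun h2 => by
    have := Int.natAbs_odd.2 h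
    rw [← Nat.not_even_iff_odd] at this
    exact this (even_iff_two_dvd.2 h2)

/-- Lifting the exponent for even exponents, with `v₂(q - 1) = 1` because `q ≡ 3` mod 4. -/
theorem padicValInt_pow_two_mul_sub_one {q m : ℕ} (hm : 2 ≤ m) (hq : padicValNat 2 (q + 1) = m)
    {i : ℕ} (hi : i ≠ 0) : padicValInt 2 ((q : ℤ) ^ (2 * i) - 1) = m + 1 + padicValNat 2 i := by
  have h4 := mod_four_eq_three hm hq
  have h := padicValNat.pow_two_sub_pow (x := q) (y := 1) (by omega) (by omega) (by omega)
    (n := 2 * i) (by omega) (even_two_mul i)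
  rw [hq, padicValNat_two_of_mod_four (a := q - 1) (by omega), one_pow,
    padicValNat.mul (by norm_num) hi, padicValNat_self] at h
  have h1 : ((q : ℤ) ^ (2 * i) - 1) = ((q ^ (2 * i) - 1 : ℕ) : ℤ) := by
    rw [Nat.cast_sub (Nat.one_le_pow _ _ (by omega))]
    simp
  rw [h1, padicValInt.of_nat]
  omega

theorem even_pow_add_sign {q : ℕ} (hq : Odd q) {ε : ℤ} (hε : ε = 1 ∨ ε = -1) (d : ℕ) :
    Even ((q : ℤ) ^ d + ε) := by
  have h : Odd ((q : ℤ) ^ d) := Odd.pow (by exact_mod_cast hq)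
  rcases hε with rfl | rfl
  · exact h.add_one
  · exact h.sub_odd odd_one

theorem pow_add_sign_ne_zero {q : ℕ} (hq : 2 ≤ q) {ε : ℤ} (hε : ε = 1 ∨ ε = -1) {d : ℕ}
    (hd : d ≠ 0) : (q : ℤ) ^ d + ε ≠ 0 := by
  have h : 1 < q ^ d := Nat.one_lt_pow hd (by omega)
  have h' : (1 : ℤ) < (q : ℤ) ^ d := by exact_mod_cast h
  rcases hε with rfl | rfl <;> omega

/-- The two factors multiply to `q^(2d) - 1`. Only the sum of the valuations is independent of `ε`,
so the two factors have to be used together. -/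
theorem padicValInt_pow_add_sign_add {q m : ℕ} (hm : 2 ≤ m) (hq : padicValNat 2 (q + 1) = m)
    {ε : ℤ} (hε : ε = 1 ∨ ε = -1) {d : ℕ} (hd : d ≠ 0) :
    padicValInt 2 ((q : ℤ) ^ d + ε) + padicValInt 2 ((q : ℤ) ^ d - ε) =
      m + 1 + padicValNat 2 d := by
  have h4 := mod_four_eq_three hm hq
  have hε' : -ε = 1 ∨ -ε = -1 := by rcases hε with rfl | rfl <;> simp
  rw [← padicValInt_pow_two_mul_sub_one hm hq hd,
    ← padicValInt.mul (pow_add_sign_ne_zero (by omega) hε hd)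
      (by simpa [sub_eq_add_neg] using pow_add_sign_ne_zero (q := q) (by omega) hε' hd)]
  congr 1
  rcases hε with rfl | rfl <;> ring

theorem one_le_padicValInt_two {a : ℤ} (ha : a ≠ 0) (h : Even a) : 1 ≤ padicValInt 2 a := by
  have h2 : (2 : ℤ) ^ 1 ∣ a := by simpa using h.two_dvd
  have := (padicValInt_dvd_iff (p := 2) 1 a).1 (by exact_mod_cast h2)
  tauto

/-- For odd `j` the companion factor `q^j - 1` is 2 mod 4, so `q^j + 1` carries all but one of the
factors 2 of `q^(2j) - 1`. -/
theorem padicValInt_pow_sub_neg_one_pow {q m : ℕ} (hm : 2 ≤ m) (hq : padicValNat 2 (q + 1) = m)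
    {j : ℕ} (hj : j ≠ 0) : padicValInt 2 ((q : ℤ) ^ j - (-1) ^ j) = m + padicValNat 2 j := by
  rcases Nat.even_or_odd j with h | h
  · obtain ⟨i, rfl⟩ := h.two_dvd
    rw [h.neg_one_pow, padicValInt_pow_two_mul_sub_one hm hq (by omega),
      padicValNat.mul (by norm_num) (by omega), padicValNat_self]
    ring
  · rw [h.neg_one_pow, sub_neg_eq_add]
    have h1 := padicValInt_pow_add_sign_add hm hq (Or.inl rfl) hj
    have h4 := mod_four_eq_three hm hq
    have h5 : q ^ j % 4 = 3 := by
      obtain ⟨i, rfl⟩ := h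
      rw [pow_succ, pow_mul, Nat.mul_mod, Nat.pow_mod, Nat.pow_mod q, h4]
      simp
    have h6 : padicValInt 2 ((q : ℤ) ^ j - 1) = 1 := by
      have : ((q : ℤ) ^ j - 1) = ((q ^ j - 1 : ℕ) : ℤ) := by
        rw [Nat.cast_sub (by omega)]
        simp
      rw [this, padicValInt.of_nat]
      exact padicValNat_two_of_mod_four (by omega)
    have h7 : padicValNat 2 j = 0 := padicValNat.eq_zero_of_not_dvd h.not_two_dvd_nat
    omega

theorem padicValNat_two_factorial_succ (d : ℕ) :
    padicValNat 2 (d + 1).factorial = padicValNat 2 (d + 1) + padicValNat 2 d.factorial := by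
  rw [Nat.factorial_succ, padicValNat.mul (by omega) (Nat.factorial_ne_zero d)]

end TwoAdic

/-! ### 2-parts of orthogonal groups. -/

section Orthogonal

variable {k : Type*} [Field k] {θ : k →+* k}

theorem padicValNat_isoGroup_of_finrank_zero {V : Type*} [AddCommGroup V] [Module k V] [Finite V]
    (β : V →ₗ[k] V →ₛₗ[θ] k) (h : Module.finrank k V = 0) (p : ℕ) :
    padicValNat p (Nat.card (isoGroup β)) = 0 := by
  have : Subsingleton V := Module.finrank_zero_iff.1 h
  have : Subsingleton (V ≃ₗ[k] V) := ⟨fun _ _ => LinearEquiv.ext fun _ => Subsingleton.elim _ _⟩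
  have : Nat.card (isoGroup β) = 1 := Nat.card_eq_one_iff_unique.2 ⟨inferInstance, ⟨1⟩⟩
  rw [this, padicValNat_one_right]

variable [Fintype k]

theorem odd_of_padicValNat {q m : ℕ} (hm : 2 ≤ m) (hq : padicValNat 2 (q + 1) = m) : Odd q := by
  have := mod_four_eq_three hm hq
  rw [Nat.odd_iff]
  omega

/-- In dimension `2(d+1)` there are `q^d (q^(d+1) - ε)` vectors of any attained nonzero length. The
odd-dimensional bound is a hypothesis because its own induction step uses this lemma, and the factor
with `ε` is left unestimated so that it can be paired with `q^(d+1) + ε` there. -/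
theorem padicValNat_isoGroup_even_le [DecidableEq k] {m : ℕ} (hm : 2 ≤ m) (hq : padicValNat 2 (Fintype.card k + 1) = m)
    (h2 : (2 : k) ≠ 0) {d b : ℕ}
    (hb : ∀ {V : Type u} [AddCommGroup V] [Module k V] [Finite V] (β : V →ₗ[k] V →ₛₗ[θ] k),
      IsHermitianForm β → β.SeparatingLeft → Module.finrank k V = 2 * d + 1 →
      padicValNat 2 (Nat.card (isoGroup β)) ≤ b)
    {V : Type u} [AddCommGroup V] [Module k V] [Finite V] (β : V →ₗ[k] V →ₛₗ[θ] k)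
    (hβ : IsHermitianForm β) (hs : β.SeparatingLeft) (hn : Module.finrank k V = 2 * (d + 1))
    {ε : ℤ} (hN : HasEvenCounts β (d + 1) ε) :
    padicValNat 2 (Nat.card (isoGroup β)) ≤
      padicValInt 2 ((Fintype.card k : ℤ) ^ (d + 1) - ε) + b := by
  have : Nontrivial V := Module.nontrivial_of_finrank_pos (R := k) (by omega)
  obtain ⟨v₀, hv₀⟩ := exists_anisotropic h2 hβ hs
  obtain ⟨v, hv, hle⟩ := exists_padicValNat_isoGroup_le 2 β hv₀ ⟨v₀, rfl⟩
  rw [← hv] at hv₀ hle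
  have hW := finrank_leftPerp_singleton hv₀
  refine hle.trans (Nat.add_le_add (le_of_eq ?_) (hb _ (hβ.restrict _)
    (separatingLeft_restrictForm_leftPerp hs (exists_span_singleton_sub_mem_leftPerp hv₀))
    (by omega)))
  have h1 := hN (β v v)
  rw [if_neg hv₀] at h1
  have hq0 : (Fintype.card k : ℤ) ≠ 0 := by simp
  have h3 : (vecCount β (β v v) : ℤ) =
      (Fintype.card k : ℤ) ^ d * ((Fintype.card k : ℤ) ^ (d + 1) - ε) := by
    apply mul_left_cancel₀ hq0
    rw [h1]
    ring
  have hpos := vecCount_pos_of_eq v rfl (β := β)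
  have h0 : (Fintype.card k : ℤ) ^ (d + 1) - ε ≠ 0 := by
    intro h0
    rw [h0, mul_zero] at h3
    omega
  rw [← padicValInt.of_nat, h3, padicValInt.mul (pow_ne_zero _ hq0) h0, padicValInt_two_eq_zero,
    zero_add]
  exact Odd.pow (by exact_mod_cast odd_of_padicValNat hm hq)

theorem padicValNat_isoGroup_odd_le {m : ℕ} (hm : 2 ≤ m) (hq : padicValNat 2 (Fintype.card k + 1) = m)
    (h2 : (2 : k) ≠ 0) (hθ : ∀ x, θ x = x) (d : ℕ) :
    ∀ {V : Type u} [AddCommGroup V] [Module k V] [Finite V] (β : V →ₗ[k] V →ₛₗ[θ] k),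
      IsHermitianForm β → β.SeparatingLeft → Module.finrank k V = 2 * d + 1 →
      padicValNat 2 (Nat.card (isoGroup β)) ≤ 1 + (m + 1) * d + padicValNat 2 d.factorial := by
  classical
  induction d with
  | zero =>
    intro V _ _ _ β hβ hs hn
    have : Nontrivial V := Module.nontrivial_of_finrank_pos (R := k) (by omega)
    obtain ⟨v₀, hv₀⟩ := exists_anisotropic h2 hβ hs
    obtain ⟨v, hv, hle⟩ := exists_padicValNat_isoGroup_le 2 β hv₀ ⟨v₀, rfl⟩
    rw [← hv] at hv₀ hle
    have hW := finrank_leftPerp_singleton hv₀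
    have hW0 := padicValNat_isoGroup_of_finrank_zero (restrictForm β (leftPerp β {v})) (by omega) 2
    rw [hW0] at hle
    obtain ⟨ε, hε, hN⟩ := (exists_hasCounts h2 hθ _ β hβ hs hn).2 0 rfl
    have h1 := hN (β v v)
    have hpos := vecCount_pos_of_eq v rfl (β := β)
    -- The count is `1 ± 1`, and it is positive because `v` itself is counted.
    have h3 : vecCount β (β v v) = 2 := by
      rcases hε with rfl | rfl <;> rcases quadraticChar_dichotomy hv₀ with h | h <;>
        simp [h] at h1 <;> omega
    simpa [h3] using hle
  | succ d ih =>
    intro V _ _ _ β hβ hs hn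
    have : Nontrivial V := Module.nontrivial_of_finrank_pos (R := k) (by omega)
    obtain ⟨v₀, hv₀⟩ := exists_anisotropic h2 hβ hs
    obtain ⟨v, hv, hle⟩ := exists_padicValNat_isoGroup_le 2 β hv₀ ⟨v₀, rfl⟩
    rw [← hv] at hv₀ hle
    have hW := finrank_leftPerp_singleton hv₀
    have hsW := separatingLeft_restrictForm_leftPerp hs
      (exists_span_singleton_sub_mem_leftPerp hv₀)
    -- The sign of the complement of `v` governs both descents. In `V` the sign is `ε χ(β(v,v))`,
    -- and evaluation at length `β(v,v)` cancels the character, so the factors are `q^(d+1) + ε` and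
    -- `q^(d+1) - ε` with the same `ε`.
    obtain ⟨ε, hε, hN⟩ := (exists_hasCounts h2 hθ (2 * (d + 1)) _ (hβ.restrict _) hsW
      (by omega)).1 _ rfl
    have hE := padicValNat_isoGroup_even_le hm hq h2 ih _ (hβ.restrict _) hsW (by omega) hN
    have h1 := hN.odd h2 hθ hβ hv₀ (by omega) (β v v)
    have hq0 : (Fintype.card k : ℤ) ≠ 0 := by simp
    have h3 : (vecCount β (β v v) : ℤ) =
        (Fintype.card k : ℤ) ^ (d + 1) * ((Fintype.card k : ℤ) ^ (d + 1) + ε) := by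
      rw [h1]
      linear_combination ε * (Fintype.card k : ℤ) ^ (d + 1) * quadraticChar_sq_one hv₀
    have h0 := pow_add_sign_ne_zero (q := Fintype.card k) (Fintype.one_lt_card) hε
      (Nat.succ_ne_zero d)
    have h4 := padicValInt_pow_add_sign_add hm hq hε (Nat.succ_ne_zero d)
    rw [← padicValInt.of_nat (n := vecCount β (β v v)), h3,
      padicValInt.mul (pow_ne_zero _ hq0) h0, padicValInt_two_eq_zero
      (Odd.pow (by exact_mod_cast odd_of_padicValNat hm hq)), zero_add] at hle
    rw [padicValNat_two_factorial_succ]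
    simp only [Nat.succ_eq_add_one] at h4
    linarith

/-- Orthogonal groups over a field with `q` elements, where `2 ^ m` is the `2`-part of `q + 1`. -/
theorem padicValNat_isoGroup_symmetric_le {m : ℕ} (hm : 2 ≤ m) (hq : padicValNat 2 (Fintype.card k + 1) = m)
    (h2 : (2 : k) ≠ 0) (hθ : ∀ x, θ x = x) 
    {V : Type u} [AddCommGroup V] [Module k V] [Finite V]
    (β : V →ₗ[k] V →ₛₗ[θ] k) (hβ : IsHermitianForm β) (hs : β.SeparatingLeft) {n : ℕ}
    (hn : Module.finrank k V = n) : padicValNat 2 (Nat.card (isoGroup β)) ≤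
      (n - n / 2) + m * (n / 2) + padicValNat 2 (n / 2).factorial := by
  classical
  obtain ⟨d, rfl | rfl⟩ := Nat.even_or_odd' n
  · rcases d with _ | d
    · rw [padicValNat_isoGroup_of_finrank_zero _ (by omega)]
      exact Nat.zero_le _
    · obtain ⟨ε, hε, hN⟩ := (exists_hasCounts h2 hθ (2 * (d + 1)) _ hβ hs hn).1 _ rfl
      have hE := padicValNat_isoGroup_even_le hm hq h2
        (padicValNat_isoGroup_odd_le hm hq h2 hθ d) _ hβ hs hn hN
      have h0 := pow_add_sign_ne_zero (q := Fintype.card k) (Fintype.one_lt_card) hε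
        (Nat.succ_ne_zero d)
      have h4 := padicValInt_pow_add_sign_add hm hq hε (Nat.succ_ne_zero d)
      -- The unused factor `q^(d+1) + ε` is even, so `q^(d+1) - ε` has valuation at most `m +
      -- v₂(d+1)`; this saves the one unit needed in even dimension.
      have h5 := one_le_padicValInt_two h0
        (even_pow_add_sign (odd_of_padicValNat hm hq) hε _)
      rw [show 2 * (d + 1) / 2 = d + 1 by omega, padicValNat_two_factorial_succ,
        show 2 * (d + 1) - (d + 1) = d + 1 by omega]
      simp only [Nat.succ_eq_add_one] at h4 h5
      linarith
  · have := padicValNat_isoGroup_odd_le hm hq h2 hθ d β hβ hs hn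
    rw [show (2 * d + 1) / 2 = d by omega, show 2 * d + 1 - d = d + 1 by omega]
    linarith

end Orthogonal

/-! ### Symplectic groups: hyperbolic pairs replace anisotropic vectors. -/

section Symplectic

variable {k : Type*} [Field k] {V : Type*} [AddCommGroup V] [Module k V] {θ : k →+* k}

theorem IsSkewHermitianForm.restrict {β : V →ₗ[k] V →ₛₗ[θ] k} (h : IsSkewHermitianForm β)
    (W : Submodule k V) : IsSkewHermitianForm (restrictForm β W) := fun v w => h v w

theorem IsSkewHermitianForm.apply_self_eq_zero (h2 : (2 : k) ≠ 0) (hθ : ∀ x, θ x = x)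
    {β : V →ₗ[k] V →ₛₗ[θ] k} (h : IsSkewHermitianForm β) (v : V) : β v v = 0 := by
  have h1 := h v v
  rw [hθ] at h1
  have h3 : 2 * β v v = 0 := by linear_combination h1
  simpa [h2] using h3

section HyperbolicPair

variable {β : V →ₗ[k] V →ₛₗ[θ] k} {e f : V}

theorem exists_span_pair_sub_mem_leftPerp (hee : β e e = 0) (hff : β f f = 0) (hef : β e f = 1)
    (hfe : β f e = -1) (x : V) : ∃ u ∈ Submodule.span k {e, f}, x - u ∈ leftPerp β {e, f} := by
  refine ⟨β x f • e - β x e • f, Submodule.sub_mem _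
    (Submodule.smul_mem _ _ (Submodule.subset_span (Set.mem_insert _ _)))
    (Submodule.smul_mem _ _ (Submodule.subset_span (Set.mem_insert_of_mem _ rfl))), ?_⟩
  rintro _ (rfl | rfl) <;> simp [hee, hff, hef, hfe]

theorem finrank_leftPerp_pair [FiniteDimensional k V] (hee : β e e = 0) (hff : β f f = 0)
    (hef : β e f = 1) (hfe : β f e = -1) :
    Module.finrank k (leftPerp β {e, f}) + 2 = Module.finrank k V := by
  let L : V →ₗ[k] k × k := (β.flip e).prod (β.flip f)
  have hL : ∀ x, L x = (β x e, β x f) := fun x => rfl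
  have hker : LinearMap.ker L = leftPerp β {e, f} := by
    ext x
    simp [hL, mem_leftPerp]
  have hrange : LinearMap.range L = ⊤ := by
    rw [LinearMap.range_eq_top]
    rintro ⟨a, c⟩
    refine ⟨c • e - a • f, ?_⟩
    simp [hL, hee, hff, hef, hfe]
  have h := LinearMap.finrank_range_add_finrank_ker L
  rw [hker, hrange, finrank_top, Module.finrank_prod, Module.finrank_self] at h
  omega

end HyperbolicPair

theorem natCard_fiber_mul [Fintype k] [Finite V] {L : V →ₗ[k] k} (hL : L ≠ 0) (c : k) :
    Nat.card {f // L f = c} * Fintype.card k = Nat.card V := by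
  have hsurj : Function.Surjective L := LinearMap.surjective hL
  have h : ∀ a, Nat.card {f // L f = a} = Nat.card {f // L f = c} := by
    intro a
    obtain ⟨x, hx⟩ := hsurj (c - a)
    refine Nat.card_congr ((Equiv.addRight x).subtypeEquiv fun f => ?_)
    simp [hx, ← eq_sub_iff_add_eq]
  rw [← Nat.card_congr (Equiv.sigmaFiberEquiv L), Nat.card_sigma]
  simp [h, mul_comm]

theorem padicValNat_card_hyperbolicPairs [Fintype k] [Finite V] (hodd : Odd (Fintype.card k))
    {β : V →ₗ[k] V →ₛₗ[θ] k} (hβ : IsSkewHermitianForm β) (hθ : ∀ x, θ x = x)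
    (hs : β.SeparatingLeft) {n : ℕ} (hn : Module.finrank k V = n + 1) :
    padicValNat 2 (Nat.card {x : V × V | β x.1 x.2 = 1}) =
      padicValInt 2 ((Fintype.card k : ℤ) ^ (n + 1) - 1) := by
  classical
  have := Fintype.ofFinite V
  have hq : Fintype.card k ≠ 0 := Fintype.card_ne_zero
  have hV := natCard_eq_pow_of_finrank (k := k) hn
  have hcard : Nat.card {x : V × V | β x.1 x.2 = 1} =
      (Fintype.card k ^ (n + 1) - 1) * Fintype.card k ^ n := by
    have h1 : Nat.card {x : V × V | β x.1 x.2 = 1} = ∑ e : V, Nat.card {f // β e f = 1} := by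
      rw [← Nat.card_sigma]
      exact Nat.card_congr ⟨fun x => ⟨x.1.1, x.1.2, x.2⟩, fun x => ⟨(x.1, x.2.1), x.2.2⟩,
        fun _ => rfl, fun _ => rfl⟩
    have h2 : ∀ e : V, Nat.card {f // β e f = 1} = if e = 0 then 0 else Fintype.card k ^ n := by
      intro e
      split_ifs with he
      · simp [he]
      · have hL : β.flip e ≠ 0 := by
          intro h0
          refine he (hs e fun w => ?_)
          have h3 : β w e = 0 := LinearMap.congr_fun h0 w
          rw [hβ w e, h3, map_zero, neg_zero]
        have h4 := natCard_fiber_mul hL (-1)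
        rw [hV, pow_succ] at h4
        have h5 : Nat.card {f // β e f = 1} = Nat.card {f // β.flip e f = -1} := by
          refine Nat.card_congr (Equiv.subtypeEquivRight fun f => ?_)
          rw [LinearMap.flip_apply, hβ e f, hθ, neg_inj]
        rw [h5]
        exact Nat.eq_of_mul_eq_mul_right (Nat.pos_of_ne_zero hq) h4
    rw [h1]
    simp_rw [h2]
    rw [Finset.sum_ite, Finset.sum_const_zero, zero_add, Finset.sum_const, Finset.filter_ne',
      Finset.card_erase_of_mem (Finset.mem_univ _), Finset.card_univ, smul_eq_mul,
      ← Nat.card_eq_fintype_card, hV]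
  have h1 : 1 < Fintype.card k ^ (n + 1) :=
    Nat.one_lt_pow (Nat.succ_ne_zero n) Fintype.one_lt_card
  have h0 : ((Fintype.card k : ℤ) ^ (n + 1) - 1) = ((Fintype.card k ^ (n + 1) - 1 : ℕ) : ℤ) := by
    rw [Nat.cast_sub h1.le]
    simp
  rw [hcard, h0, padicValInt.of_nat, padicValNat.mul (by omega) (pow_ne_zero _ hq),
    padicValNat.eq_zero_of_not_dvd (n := Fintype.card k ^ n), add_zero]
  rw [← even_iff_two_dvd, Nat.not_even_iff_odd]
  exact hodd.pow

/-- The symplectic analogue of `exists_padicValNat_isoGroup_le`. -/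
theorem exists_padicValNat_isoGroup_pair_le [Fintype k] [Finite V]
    (h2 : (2 : k) ≠ 0) {β : V →ₗ[k] V →ₛₗ[θ] k} (hβ : IsSkewHermitianForm β)
    (hθ : ∀ x, θ x = x) (hs : β.SeparatingLeft) [Nontrivial V] :
    ∃ e f : V, β e f = 1 ∧ padicValNat 2 (Nat.card (isoGroup β)) ≤
      padicValNat 2 (Nat.card {x : V × V | β x.1 x.2 = 1}) +
      padicValNat 2 (Nat.card (isoGroup (restrictForm β (leftPerp β {e, f})))) := by
  have hfin : Finite (V ≃ₗ[k] V) := Finite.of_injective (fun g => (g : V → V)) DFunLike.coe_injective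
  have hne : {x : V × V | β x.1 x.2 = 1}.Nonempty := by
    obtain ⟨v, hv⟩ := exists_ne (0 : V)
    have : ∃ w, β v w ≠ 0 := by
      by_contra! h0
      exact hv (hs v h0)
    obtain ⟨w, hw⟩ := this
    exact ⟨((β v w)⁻¹ • v, w), by simp [hw]⟩
  obtain ⟨⟨e, f⟩, hef, h⟩ := exists_padicValNat_card_le_stabilizer (G := isoGroup β) 2
    {x : V × V | β x.1 x.2 = 1} (Set.toFinite _) hne (fun g x hx => (g.2 x.1 x.2).trans hx)
  have hef' : β e f = 1 := hef
  have hfe : β f e = -1 := by rw [hβ e f, hef', map_one]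
  refine ⟨e, f, hef, h.trans (Nat.add_le_add_left ?_ _)⟩
  have hfin' : Finite (leftPerp β {e, f} ≃ₗ[k] leftPerp β {e, f}) :=
    Finite.of_injective (fun g => (g : _ → _)) DFunLike.coe_injective
  refine (padicValNat_dvd_iff_le Nat.card_pos.ne').1 (pow_padicValNat_dvd.trans ?_)
  refine card_dvd_card_isoGroup_leftPerp β (exists_span_pair_sub_mem_leftPerp
    (hβ.apply_self_eq_zero h2 hθ e) (hβ.apply_self_eq_zero h2 hθ f) hef hfe) _ ?_
  rintro g hg _ (rfl | rfl)
  · exact congrArg Prod.fst hg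
  · exact congrArg Prod.snd hg

/-- Symplectic groups over a field with `q` elements, where `2 ^ m` is the `2`-part of `q + 1`. -/
theorem padicValNat_isoGroup_alternating_le [Fintype k] {m : ℕ} (hm : 2 ≤ m)
    (hq : padicValNat 2 (Fintype.card k + 1) = m) (h2 : (2 : k) ≠ 0) (hθ : ∀ x, θ x = x) (n : ℕ) :
    ∀ {V : Type u} [AddCommGroup V] [Module k V] [Finite V] (β : V →ₗ[k] V →ₛₗ[θ] k),
      IsSkewHermitianForm β → β.SeparatingLeft → Module.finrank k V = n →
      Even n ∧ padicValNat 2 (Nat.card (isoGroup β)) ≤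
        (n - n / 2) + m * (n / 2) + padicValNat 2 (n / 2).factorial := by
  induction n using Nat.strong_induction_on with
  | _ n ih =>
    intro V _ _ _ β hβ hs hn
    rcases n with _ | n
    · rw [padicValNat_isoGroup_of_finrank_zero _ hn]
      exact ⟨Even.zero, Nat.zero_le _⟩
    have : Nontrivial V := Module.nontrivial_of_finrank_pos (R := k) (by omega)
    obtain ⟨e, f, hef, hle⟩ := exists_padicValNat_isoGroup_pair_le h2 hβ hθ hs
    have hee := hβ.apply_self_eq_zero h2 hθ e
    have hff := hβ.apply_self_eq_zero h2 hθ f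
    have hfe : β f e = -1 := by rw [hβ e f, hef, map_one]
    have hW := finrank_leftPerp_pair hee hff hef hfe
    -- The dimension drops by two, from `n + 1` to `n - 1`. When `n = 0` the truncated subtraction
    -- is harmless, since `hW` is then contradictory.
    obtain ⟨hev, hb⟩ := ih (n - 1) (by omega) _ (hβ.restrict (leftPerp β {e, f}))
      (separatingLeft_restrictForm_leftPerp hs
        (exists_span_pair_sub_mem_leftPerp hee hff hef hfe)) (by omega)
    obtain ⟨d, hd⟩ := hev.two_dvd
    obtain rfl : n = 2 * d + 1 := by omega
    refine ⟨⟨d + 1, by ring⟩, ?_⟩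
    rw [padicValNat_card_hyperbolicPairs (odd_of_padicValNat hm hq) hβ hθ hs hn,
      show 2 * d + 1 + 1 = 2 * (d + 1) by ring,
      padicValInt_pow_two_mul_sub_one hm hq (Nat.succ_ne_zero d)] at hle
    rw [show 2 * d + 1 + 1 - (2 * d + 1 + 1) / 2 = d + 1 by omega,
      show (2 * d + 1 + 1) / 2 = d + 1 by omega, padicValNat_two_factorial_succ]
    rw [hd, show 2 * d - 2 * d / 2 = d by omega, show 2 * d / 2 = d by omega] at hb
    linarith

end Symplectic

/-! ### 2-parts of unitary groups over fields with `q²` elements. -/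

section Unitary

variable {k : Type*} [Field k] [Fintype k] {θ : k →+* k} {q : ℕ}

/-- Fibres of the norm to the subfield of order `q`. The unit group is cyclic of order `(q+1)(q-1)`,
so `y^(q-1) = 1` makes `y` a `(q+1)`-th power, and the fibre is a coset of the `(q+1)`-th roots of
unity. -/
theorem card_pow_succ_eq [DecidableEq k] (hk : Fintype.card k = q ^ 2) {y : k} (hy : y ≠ 0)
    (hyq : y ^ q = y) : (Finset.univ.filter fun x : k => x ^ (q + 1) = y).card = q + 1 := by
  have hq : 1 < q := by
    by_contra! h
    have h1 : Fintype.card k ≤ 1 := hk ▸ Nat.pow_le_one_iff (by norm_num) |>.2 h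
    exact absurd Fintype.one_lt_card (not_lt.2 h1)
  have hk' : Fintype.card kˣ = (q + 1) * (q - 1) := by
    rw [Fintype.card_units, hk]
    simpa using Nat.sq_sub_sq q 1
  obtain ⟨g, hg⟩ := IsCyclic.exists_generator (α := kˣ)
  have hog : orderOf g = (q + 1) * (q - 1) := by
    rw [orderOf_eq_card_of_forall_mem_zpowers hg, Nat.card_eq_fintype_card, hk']
  have hprim : IsPrimitiveRoot ((g : k) ^ (q - 1)) (q + 1) := by
    have h1 : IsPrimitiveRoot (g : k) ((q + 1) * (q - 1)) :=
      IsPrimitiveRoot.coe_units_iff.2 (hog ▸ IsPrimitiveRoot.orderOf g)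
    exact h1.pow (Nat.mul_pos (by omega) (by omega)) (mul_comm _ _)
  have hroot : ∃ α : k, α ^ (q + 1) = y := by
    obtain ⟨j, hj⟩ := (Submonoid.mem_powers_iff (Units.mk0 y hy) g).1
      (mem_powers_iff_mem_zpowers.2 (hg _))
    have h1 : (Units.mk0 y hy) ^ (q - 1) = 1 := by
      ext
      have : y ^ (q - 1) * y = 1 * y := by
        rw [← pow_succ, Nat.sub_add_cancel hq.le, hyq, one_mul]
      simpa using mul_right_cancel₀ hy this
    rw [← hj, ← pow_mul, ← orderOf_dvd_iff_pow_eq_one, hog] at h1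
    obtain ⟨i, rfl⟩ := Nat.dvd_of_mul_dvd_mul_right (by omega) h1
    refine ⟨(g : k) ^ i, ?_⟩
    rw [← pow_mul, mul_comm]
    exact congrArg Units.val hj
  have h := hprim.card_nthRoots y
  rw [if_pos hroot, ← Multiset.toFinset_card_of_nodup (hprim.nthRoots_nodup hy)] at h
  refine Eq.trans (congrArg _ ?_) h
  ext x
  simp [Polynomial.mem_nthRoots (Nat.succ_pos q)]

variable {V : Type*} [AddCommGroup V] [Module k V]

/-- Norm fibres have `q + 1` elements over nonzero fixed values but one over 0. Raising that weight
to `q + 1` costs `q` times the count of the complement at `c`, after which all lengths have equal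
weight. Values `y` not fixed by `θ` contribute nothing, as hermitian lengths are fixed. -/
theorem vecCount_add_mul_vecCount [Finite V] (hk : Fintype.card k = q ^ 2) (hθ : ∀ x, θ x = x ^ q)
    {β : V →ₗ[k] V →ₛₗ[θ] k} (hβ : IsHermitianForm β) {v : V} (hv : β v v ≠ 0) {c : k}
    (hc : θ c = c) :
    vecCount β c + q * vecCount (restrictForm β (leftPerp β {v})) c =
      (q + 1) * Nat.card (leftPerp β {v}) := by
  classical
  have hb : θ (β v v) = β v v := (hβ v v).symm
  have key : ∀ y : k, (Finset.univ.filter fun x : k => x * θ x * β v v = y).card *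
      vecCount (restrictForm β (leftPerp β {v})) (c - y) +
      (if y = 0 then q * vecCount (restrictForm β (leftPerp β {v})) c else 0) =
      (q + 1) * vecCount (restrictForm β (leftPerp β {v})) (c - y) := by
    intro y
    split_ifs with hy
    · subst hy
      have : (Finset.univ.filter fun x : k => x * θ x * β v v = 0) = {0} := by
        ext x
        simp [hv]
      rw [this, Finset.card_singleton, sub_zero]
      ring
    · by_cases hyθ : θ y = y
      · have h1 := card_pow_succ_eq hk (y := y / β v v) (div_ne_zero hy hv)
          (by rw [← hθ, map_div₀, hyθ, hb])
        have h2 : (Finset.univ.filter fun x : k => x * θ x * β v v = y) =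
            Finset.univ.filter fun x : k => x ^ (q + 1) = y / β v v := by
          ext x
          simp [hθ, eq_div_iff hv, pow_succ']
        rw [h2, h1, add_zero]
      · have : IsEmpty {w : leftPerp β {v} // restrictForm β (leftPerp β {v}) w w = c - y} := by
          refine ⟨fun w => hyθ ?_⟩
          have h3 := hβ.restrict (leftPerp β {v}) w.1 w.1
          rw [w.2, map_sub, hc] at h3
          exact (sub_right_injective h3).symm
        have h0 : vecCount (restrictForm β (leftPerp β {v})) (c - y) = 0 := Nat.card_of_isEmpty
        rw [h0]
        simp
  rw [vecCount_eq_sum hβ hv c, ← sum_vecCount (restrictForm β (leftPerp β {v})),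
    ← Finset.sum_fiberwise' Finset.univ (fun x : k => x * θ x * β v v)
      fun y => vecCount (restrictForm β (leftPerp β {v})) (c - y)]
  have h := Finset.sum_congr (rfl : (Finset.univ : Finset k) = _) fun y _ => key y
  rw [Finset.sum_add_distrib, Finset.sum_ite_eq' Finset.univ (0 : k),
    if_pos (Finset.mem_univ _), ← Finset.mul_sum] at h
  simp_rw [Finset.sum_const, smul_eq_mul]
  rw [h]
  congr 1
  exact Fintype.sum_equiv (Equiv.subLeft c) _ _ fun _ => rfl

/-- Solves the recursion `N' = (q+1) q^(2n) - q N`. Unlike the symmetric case the sign is forced to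
be `(-1)^n`; the factor `q` on the left avoids `q^(n-1)` at `n = 0`. -/
theorem mul_vecCount_hermitian (hk : Fintype.card k = q ^ 2) (h2 : (2 : k) ≠ 0)
    (hθ : ∀ x, θ x = x ^ q) [DecidableEq k] (n : ℕ) :
    ∀ {V : Type u} [AddCommGroup V] [Module k V] [Finite V] (β : V →ₗ[k] V →ₛₗ[θ] k),
      IsHermitianForm β → β.SeparatingLeft → Module.finrank k V = n → ∀ c, θ c = c →
      (q : ℤ) * vecCount β c = (q : ℤ) ^ (2 * n) +
        (-1) ^ n * ((if c = 0 then (q : ℤ) ^ (n + 1) else 0) - (q : ℤ) ^ n) := by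
  induction n with
  | zero =>
    intro V _ _ _ β hβ hs hn c hc
    have : Subsingleton V := Module.finrank_zero_iff.1 hn
    have h : vecCount β c = if c = 0 then 1 else 0 := by
      unfold vecCount
      split_ifs with ha
      · exact Nat.card_eq_one_iff_unique.2 ⟨inferInstance, ⟨⟨0, by simp [ha]⟩⟩⟩
      · have : IsEmpty {v : V // β v v = c} :=
          ⟨fun v => ha (by rw [← v.2, Subsingleton.elim (v : V) 0]; simp)⟩
        exact Nat.card_of_isEmpty
    rw [h]
    split_ifs <;> simp
  | succ n ih =>
    intro V _ _ _ β hβ hs hn c hc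
    have : Nontrivial V := Module.nontrivial_of_finrank_pos (R := k) (by omega)
    obtain ⟨v, hv⟩ := exists_anisotropic h2 hβ hs
    have hW : Module.finrank k (leftPerp β {v}) = n := by
      have := finrank_leftPerp_singleton hv
      omega
    have h1 := ih (restrictForm β (leftPerp β {v})) (hβ.restrict _)
      (separatingLeft_restrictForm_leftPerp hs (exists_span_singleton_sub_mem_leftPerp hv)) hW c hc
    have h3 := vecCount_add_mul_vecCount hk hθ hβ hv hc
    rw [natCard_eq_pow_of_finrank hW, hk] at h3
    zify at h3
    have h4 : (vecCount β c : ℤ) = (q + 1) * ((q : ℤ) ^ 2) ^ n -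
      q * vecCount (restrictForm β (leftPerp β {v})) c := by linear_combination h3
    rw [h4, h1]
    split_ifs <;> ring

/-- Unitary groups over a field with `q ^ 2` elements, where `2 ^ m` is the `2`-part of `q + 1`. -/
theorem padicValNat_isoGroup_hermitian_le {m : ℕ} (hm : 2 ≤ m) (hq : padicValNat 2 (q + 1) = m)
    (hk : Fintype.card k = q ^ 2) (h2 : (2 : k) ≠ 0) (hθ : ∀ x, θ x = x ^ q) (n : ℕ) :
    ∀ {V : Type u} [AddCommGroup V] [Module k V] [Finite V] (β : V →ₗ[k] V →ₛₗ[θ] k),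
      IsHermitianForm β → β.SeparatingLeft → Module.finrank k V = n →
      padicValNat 2 (Nat.card (isoGroup β)) ≤ m * n + padicValNat 2 n.factorial := by
  classical
  induction n with
  | zero =>
    intro V _ _ _ β hβ hs hn
    rw [padicValNat_isoGroup_of_finrank_zero _ hn]
    exact Nat.zero_le _
  | succ n ih =>
    intro V _ _ _ β hβ hs hn
    have : Nontrivial V := Module.nontrivial_of_finrank_pos (R := k) (by omega)
    obtain ⟨v₀, hv₀⟩ := exists_anisotropic h2 hβ hs
    obtain ⟨v, hv, hle⟩ := exists_padicValNat_isoGroup_le 2 β hv₀ ⟨v₀, rfl⟩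
    rw [← hv] at hv₀ hle
    have hW := finrank_leftPerp_singleton hv₀
    have hb := ih _ (hβ.restrict (leftPerp β {v})) (separatingLeft_restrictForm_leftPerp hs
      (exists_span_singleton_sub_mem_leftPerp hv₀)) (by omega)
    have h1 := mul_vecCount_hermitian hk h2 hθ (n + 1) β hβ hs hn (β v v) (hβ v v).symm
    rw [if_neg hv₀] at h1
    have h4 := mod_four_eq_three hm hq
    have hq0 : (q : ℤ) ≠ 0 := by
      rintro h
      norm_cast at h
      omega
    have h3 : (vecCount β (β v v) : ℤ) = (q : ℤ) ^ n * ((q : ℤ) ^ (n + 1) - (-1) ^ (n + 1)) := by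
      apply mul_left_cancel₀ hq0
      rw [h1]
      ring
    have hpos := vecCount_pos_of_eq v rfl (β := β)
    have h0 : (q : ℤ) ^ (n + 1) - (-1) ^ (n + 1) ≠ 0 := by
      intro h0
      rw [h0, mul_zero] at h3
      omega
    rw [← padicValInt.of_nat (n := vecCount β (β v v)), h3,
      padicValInt.mul (pow_ne_zero _ hq0) h0,
      padicValInt_two_eq_zero (Odd.pow (by exact_mod_cast odd_of_padicValNat hm hq)), zero_add,
      padicValInt_pow_sub_neg_one_pow hm hq (Nat.succ_ne_zero n)] at hle
    rw [padicValNat_two_factorial_succ]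
    linarith

end Unitary

/-! ### Passing between skew-hermitian and hermitian forms. -/

section Scaling

variable {k : Type*} [Field k] {V : Type*} [AddCommGroup V] [Module k V] {θ : k →+* k}

theorem isoGroup_smul (β : V →ₗ[k] V →ₛₗ[θ] k) {s : k} (hs : s ≠ 0) :
    isoGroup (s • β) = isoGroup β := by
  ext g
  refine forall₂_congr fun v w => ?_
  simp [hs]

theorem separatingLeft_smul {β : V →ₗ[k] V →ₛₗ[θ] k} (hβ : β.SeparatingLeft) {s : k}
    (hs : s ≠ 0) : (s • β).SeparatingLeft := fun v hv => hβ v fun w => by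
  simpa [hs] using hv w

/-- The scalar `s = x - θ x` is nonzero and satisfies `θ s = -s`, which absorbs the sign. -/
theorem IsSkewHermitianForm.exists_isHermitianForm_smul {β : V →ₗ[k] V →ₛₗ[θ] k}
    (hβ : IsSkewHermitianForm β) (hθ : ∀ x, θ (θ x) = x) {x : k} (hx : θ x ≠ x) :
    ∃ s : k, s ≠ 0 ∧ IsHermitianForm (s • β) := by
  refine ⟨x - θ x, sub_ne_zero.2 hx.symm, fun v w => ?_⟩
  simp [hβ v w, hθ]
  ring

end Scaling

/-! ### Subfields of `ℚ(μ_{ℓ^∞})`. -/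

section Cyclotomic

theorem isCyclotomicExtension_adjoin_singleton {F L : Type*} [Field F] [Field L] [Algebra F L]
    {n : ℕ} [NeZero n] {ζ : L} (hζ : IsPrimitiveRoot ζ n) :
    IsCyclotomicExtension {n} F (IntermediateField.adjoin F {ζ}) := by
  change IsCyclotomicExtension {n} F (IntermediateField.adjoin F {ζ}).toSubalgebra
  have hint : IsIntegral F ζ := hζ.isIntegral (NeZero.pos n) |>.tower_top
  rw [IntermediateField.adjoin_simple_toSubalgebra_of_isAlgebraic hint.isAlgebraic]
  exact hζ.adjoin_isCyclotomicExtension F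

instance isCyclotomicExtension_cyclo (n : ℕ) [NeZero n] : IsCyclotomicExtension {n} ℚ (cyclo n) :=
  isCyclotomicExtension_adjoin_singleton (Complex.isPrimitiveRoot_exp n (NeZero.ne n))

theorem mem_cyclo_of_pow_eq_one {n : ℕ} (hn : n ≠ 0) {z : ℂ} (hz : z ^ n = 1) : z ∈ cyclo n := by
  have : NeZero n := ⟨hn⟩
  obtain ⟨i, -, rfl⟩ := (Complex.isPrimitiveRoot_exp n hn).eq_pow_of_pow_eq_one hz
  exact pow_mem (IntermediateField.mem_adjoin_simple_self ℚ _) _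

theorem cyclo_eq_adjoin {n : ℕ} (hn : n ≠ 0) {ζ : ℂ} (hζ : IsPrimitiveRoot ζ n) :
    cyclo n = IntermediateField.adjoin ℚ {ζ} := by
  have : NeZero n := ⟨hn⟩
  refine le_antisymm ?_ ?_
  · obtain ⟨i, -, hi⟩ := hζ.eq_pow_of_pow_eq_one (Complex.isPrimitiveRoot_exp n hn).pow_eq_one
    refine IntermediateField.adjoin_le_iff.2 (Set.singleton_subset_iff.2 ?_)
    exact hi ▸ pow_mem (IntermediateField.mem_adjoin_simple_self ℚ _) _
  · exact IntermediateField.adjoin_le_iff.2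
      (Set.singleton_subset_iff.2 (mem_cyclo_of_pow_eq_one hn hζ.pow_eq_one))

/-- A primitive element of `K` involves only finitely many roots of unity. -/
theorem exists_le_cyclo {l : ℕ} (hl : l ≠ 0) (K : IntermediateField ℚ ℂ) [FiniteDimensional ℚ K]
    (hK : K ≤ cycloInf l) : ∃ M, K ≤ cyclo (l ^ M) := by
  have h1 : ∀ x ∈ K, ∃ M, x ∈ cyclo (l ^ M) := by
    intro x hx
    obtain ⟨T, hT, hxT⟩ := IntermediateField.exists_finset_of_mem_adjoin (hK hx)
    choose! f hf using fun z (hz : z ∈ T) => hT hz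
    refine ⟨T.sup f, (IntermediateField.adjoin_le_iff.2 fun z hz => ?_ :
      IntermediateField.adjoin ℚ (T : Set ℂ) ≤ cyclo (l ^ T.sup f)) hxT⟩
    exact cyclo_mono hl (Finset.le_sup hz) (mem_cyclo_of_pow_eq_one (pow_ne_zero _ hl) (hf z hz))
  obtain ⟨α, hα⟩ := Field.exists_primitive_element ℚ K
  obtain ⟨M, hM⟩ := h1 α α.2
  refine ⟨M, ?_⟩
  have h2 : IntermediateField.adjoin ℚ {(α : ℂ)} = K := by
    have h3 := congrArg IntermediateField.lift hα
    exact (IntermediateField.lift_adjoin_simple ℚ K α).symm.trans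
      (h3.trans (IntermediateField.lift_top ℚ K))
  rw [← h2]
  exact IntermediateField.adjoin_le_iff.2 (Set.singleton_subset_iff.2 hM)

/-- Far enough along the chain the intersection is `K` itself, and it already has that value at
`m(K,ℓ)`. -/
theorem le_cyclo_schurM {l : ℕ} (hl : l ≠ 0) (K : IntermediateField ℚ ℂ) [FiniteDimensional ℚ K]
    (hK : K ≤ cycloInf l) : K ≤ cyclo (l ^ schurM K l) := by
  obtain ⟨M, hM⟩ := exists_le_cyclo hl K hK
  have h := (schurM_spec K hl).2 (max (schurM K l) M) (le_max_left _ _)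
  rw [inf_eq_left.2 (hM.trans (cyclo_mono hl (le_max_right _ _)))] at h
  exact inf_eq_left.1 h

theorem schurM_le_of_le_cyclo {l : ℕ} (hl : l ≠ 0) {K : IntermediateField ℚ ℂ} {j : ℕ} (hj : 1 ≤ j)
    (hK : K ≤ cyclo (l ^ j)) : schurM K l ≤ j := by
  refine Nat.sInf_le ⟨hj, fun k hk => ?_⟩
  rw [inf_eq_left.2 hK, inf_eq_left.2 (hK.trans (cyclo_mono hl hk))]

theorem isGalois_of_le_cyclo {n : ℕ} (hn : n ≠ 0) {K : IntermediateField ℚ ℂ} (hK : K ≤ cyclo n) :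
    IsGalois ℚ K := by
  have : NeZero n := ⟨hn⟩
  have h1 : IsAbelianGalois ℚ (cyclo n) := IsCyclotomicExtension.isAbelianGalois {n} ℚ (cyclo n)
  exact (@IsAbelianGalois.of_algHom ℚ K (cyclo n) _ _ _ _ _
    (IntermediateField.inclusion hK).toRingHom.toRatAlgHom h1).toIsGalois

theorem conj_mem_of_normal (K : IntermediateField ℚ ℂ) (hK : Normal ℚ K) {x : ℂ} (hx : x ∈ K) :
    conj x ∈ K := by
  let c : ℂ →ₐ[ℚ] ℂ := Complex.conjAe.toAlgHom.restrictScalars ℚ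
  have h := @AlgHom.fieldRange_of_normal ℚ ℂ _ _ _ K hK (c.comp K.val)
  have : conj x ∈ (c.comp K.val).fieldRange := ⟨⟨x, hx⟩, rfl⟩
  rwa [h] at this

end Cyclotomic

/-! ### The 2-part of the Schur bound. -/

section SchurBound

/-- Only a lower bound is needed, so it suffices that the factor at `ℓ = 2` divides the product; the
factors at odd `ℓ` need no analysis. -/
theorem le_padicValNat_schurS (n : ℕ) (K : IntermediateField ℚ ℂ) [FiniteDimensional ℚ K] :
    (n - n / schurT K 2) + schurM K 2 * (n / schurT K 2) +
      padicValNat 2 (n / schurT K 2).factorial ≤ padicValNat 2 (schurS n K) := by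
  let F := fun l : {p : ℕ // p.Prime} =>
    (l : ℕ) ^ (schurM K l * (n / schurT K l)) * pPart l (n / schurT K l).factorial
  have hF0 : ∀ l, F l ≠ 0 := fun l => mul_ne_zero (pow_ne_zero _ l.2.ne_zero)
    (pow_ne_zero _ l.2.ne_zero)
  have hfin : (Function.mulSupport F).Finite := schurS_finite_support n K
  have hS : schurS n K = 2 ^ (n - n / schurT K 2) * ∏ᶠ l, F l := rfl
  have hprod : ∏ᶠ l, F l ≠ 0 := by
    rw [finprod_eq_prod _ hfin]
    exact Finset.prod_ne_zero_iff.2 fun l _ => hF0 l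
  have hdvd : F ⟨2, Nat.prime_two⟩ ∣ ∏ᶠ l, F l := by
    by_cases h : (⟨2, Nat.prime_two⟩ : {p : ℕ // p.Prime}) ∈ Function.mulSupport F
    · rw [finprod_eq_prod _ hfin]
      exact Finset.dvd_prod_of_mem F (hfin.mem_toFinset.2 h)
    · rw [Function.notMem_mulSupport.1 h]
      exact one_dvd _
  have h2 : padicValNat 2 (F ⟨2, Nat.prime_two⟩) = schurM K 2 * (n / schurT K 2) +
      padicValNat 2 (n / schurT K 2).factorial := by
    change padicValNat 2 (2 ^ _ * 2 ^ _) = _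
    rw [← pow_add, padicValNat.prime_pow]
  rw [hS, padicValNat.mul (pow_ne_zero _ two_ne_zero) hprod, padicValNat.prime_pow, add_assoc, ← h2]
  exact Nat.add_le_add_left
    ((padicValNat_dvd_iff_le hprod).1 (pow_padicValNat_dvd.trans hdvd)) _

end SchurBound

/-! ### Unit groups modulo `2^m`. -/

section RealSubfields

/-- Write the root as `2b + 1`. Then `2^(m-2)` divides `b(b+1)`, hence one of the two coprime
factors, so the root is `±1` modulo `2^(m-1)`. -/
theorem eq_one_or_eq_of_sq_eq_one {m : ℕ} (hm : 2 ≤ m) {x : ZMod (2 ^ m)} (hx : x ^ 2 = 1) :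
    (x = 1 ∨ x = -1) ∨ (x = 1 + 2 ^ (m - 1) ∨ x = -(1 + 2 ^ (m - 1))) := by
  obtain ⟨j, rfl⟩ : ∃ j, m = j + 2 := ⟨m - 2, by omega⟩
  have key : ∀ (a : ℤ), (2 : ℤ) ^ (j + 1) ∣ a - 1 →
      ((a : ZMod (2 ^ (j + 2))) = 1 ∨ (a : ZMod (2 ^ (j + 2))) = 1 + 2 ^ (j + 1)) := by
    rintro a ⟨c, hc⟩
    have hz : ((2 : ZMod (2 ^ (j + 2))) ^ (j + 2)) = 0 := by
      have := ZMod.natCast_self (2 ^ (j + 2))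
      exact_mod_cast this
    have ha : a = 1 + 2 ^ (j + 1) * c := by linarith
    obtain ⟨d, rfl | rfl⟩ := Int.even_or_odd' c
    · left
      rw [ha]
      push_cast
      linear_combination (d : ZMod (2 ^ (j + 2))) * hz
    · right
      rw [ha]
      push_cast
      linear_combination (d : ZMod (2 ^ (j + 2))) * hz
  obtain ⟨a, rfl⟩ := ZMod.intCast_surjective x
  have hdvd : (2 : ℤ) ^ (j + 2) ∣ (a - 1) * (a + 1) := by
    have : ((a ^ 2 - 1 : ℤ) : ZMod (2 ^ (j + 2))) = 0 := by
      push_cast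
      rw [hx, sub_self]
    rw [ZMod.intCast_zmod_eq_zero_iff_dvd] at this
    have h3 : (a - 1) * (a + 1) = a ^ 2 - 1 := by ring
    rw [h3]
    exact_mod_cast this
  have hodd : Odd a := by
    have h4 : (2 : ℤ) ∣ (a - 1) * (a + 1) := (dvd_pow_self 2 (by omega)).trans hdvd
    by_contra h
    obtain ⟨b, rfl⟩ := (Int.not_odd_iff_even.1 h).two_dvd
    obtain ⟨c, hc⟩ := h4
    have : (2 * b - 1) * (2 * b + 1) = 2 * (2 * b ^ 2) - 1 := by ring
    omega
  obtain ⟨b, rfl⟩ := hodd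
  have hb : (2 : ℤ) ^ j ∣ b * (b + 1) := by
    have h5 : (2 * b + 1 - 1) * (2 * b + 1 + 1) = (b * (b + 1)) * 2 ^ 2 := by ring
    rw [h5, pow_add] at hdvd
    exact Int.dvd_of_mul_dvd_mul_right (by norm_num) hdvd
  rw [show j + 2 - 1 = j + 1 by omega]
  rcases Int.even_or_odd b with he | ho
  · have hc : IsCoprime ((2 : ℤ) ^ j) (b + 1) :=
      IsCoprime.pow_left (Int.isCoprime_two_left.2 he.add_one)
    have h6 := hc.dvd_of_dvd_mul_right hb
    rcases key (2 * b + 1) (by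
      rw [add_sub_cancel_right, pow_succ']
      exact mul_dvd_mul_left 2 h6) with h | h
    · exact Or.inl (Or.inl h)
    · exact Or.inr (Or.inl h)
  · have hc : IsCoprime ((2 : ℤ) ^ j) b := IsCoprime.pow_left (Int.isCoprime_two_left.2 ho)
    have h6 := hc.dvd_of_dvd_mul_left hb
    have h7 := key (-(2 * b + 1)) (by
      rw [show -(2 * b + 1) - 1 = -(2 * (b + 1)) by ring, pow_succ']
      exact (mul_dvd_mul_left 2 h6).neg_right)
    rw [Int.cast_neg] at h7
    rcases h7 with h | h
    · exact Or.inl (Or.inr (by rw [← h, neg_neg]))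
    · exact Or.inr (Or.inr (by rw [← h, neg_neg]))

/-- A group of units modulo `2 ^ m` containing `-1` but not `1 + 2 ^ (m - 1)` is `{1, -1}`. -/
theorem eq_one_or_eq_neg_one_of_mem {m : ℕ} (hm : 2 ≤ m) {H : Subgroup (ZMod (2 ^ m))ˣ}
    (hneg : -1 ∈ H) (hu : ∀ u ∈ H, (u : ZMod (2 ^ m)) ≠ 1 + 2 ^ (m - 1))
    {x : (ZMod (2 ^ m))ˣ} (hx : x ∈ H) : x = 1 ∨ x = -1 := by
  -- The unit group is a 2-group, so every element satisfies the premise for some `j`; induction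
  -- then reduces to `x² = ±1`.
  have key : ∀ j : ℕ, ∀ x ∈ H, x ^ 2 ^ j = 1 → x = 1 ∨ x = -1 := by
    intro j
    induction j with
    | zero => intro x _ h; left; simpa using h
    | succ j ih =>
      intro x hx h
      rcases ih (x ^ 2) (pow_mem hx 2) (by rw [← pow_mul, ← pow_succ', h]) with h2 | h2
      · have h3 : (x : ZMod (2 ^ m)) ^ 2 = 1 := by simpa using congrArg Units.val h2
        rcases eq_one_or_eq_of_sq_eq_one hm h3 with (h4 | h4) | (h4 | h4)
        · exact Or.inl (Units.ext h4)
        · exact Or.inr (Units.ext (by simpa using h4))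
        · exact absurd h4 (hu x hx)
        · refine absurd ?_ (hu (-1 * x) (mul_mem hneg hx))
          simp [h4]
      · exfalso
        have h3 : (x : ZMod (2 ^ m)) ^ 2 = -1 := by
          simpa using congrArg Units.val h2
        -- `-1` is not a square modulo 4.
        have h4 := congrArg (ZMod.castHom (pow_dvd_pow 2 hm : 2 ^ 2 ∣ 2 ^ m) (ZMod (2 ^ 2))) h3
        rw [map_pow, map_neg, map_one] at h4
        generalize ZMod.castHom (pow_dvd_pow 2 hm : 2 ^ 2 ∣ 2 ^ m) (ZMod (2 ^ 2)) _ = y at h4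
        revert h4 y
        decide
  refine key (m - 1) x hx ?_
  have := ZMod.pow_totient x
  rwa [Nat.totient_prime_pow Nat.prime_two (by omega), Nat.add_one_sub_one, mul_one] at this

end RealSubfields

/-! ### The value of `t(K,2)` for real `K`. -/

section RealSubfields

theorem conj_eq_inv_of_pow_eq_one {n : ℕ} (hn : n ≠ 0) {z : ℂ} (hz : z ^ n = 1) :
    conj z = z⁻¹ := (Complex.inv_eq_conj (Complex.norm_eq_one_of_pow_eq_one hz hn)).symm

/-- Complex conjugation as an automorphism over a field of real numbers. -/
noncomputable def conjAlgEquiv (K : IntermediateField ℚ ℂ) (hK : ∀ x ∈ K, conj x = x) :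
    ℂ ≃ₐ[K] ℂ :=
  AlgEquiv.ofRingEquiv (f := Complex.conjAe.toRingEquiv) fun x => hK x x.2

/-- The Galois group of `K(ζ)` over `K` embeds in the units modulo `2^m`. Its image contains `-1`,
given by conjugation, since `K` is real. It omits `1 + 2^(m-1)`, which fixes `ζ²` and hence would
fix `ζ ∈ K(ζ²)`. So it lies in `{±1}`. -/
theorem finrank_adjoin_le_two {K : IntermediateField ℚ ℂ} (hK : ∀ x ∈ K, conj x = x) {m : ℕ}
    (hm : 2 ≤ m) {ζ : ℂ} (hζ : IsPrimitiveRoot ζ (2 ^ m))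
    (hmem : ζ ∈ IntermediateField.adjoin K {ζ ^ 2}) :
    Module.finrank K (IntermediateField.adjoin K {ζ}) ≤ 2 := by
  have hne : NeZero (2 ^ m) := ⟨by positivity⟩
  set E := IntermediateField.adjoin K {ζ} with hE
  have hcyc : IsCyclotomicExtension {2 ^ m} K E := isCyclotomicExtension_adjoin_singleton hζ
  have hgal : IsGalois K E := IsCyclotomicExtension.isGalois {2 ^ m} K E
  have hfd : FiniteDimensional K E := IsCyclotomicExtension.finiteDimensional {2 ^ m} K E
  have hζE : ζ ∈ E := IntermediateField.mem_adjoin_simple_self K ζ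
  have hη : IsPrimitiveRoot (⟨ζ, hζE⟩ : E) (2 ^ m) := IsPrimitiveRoot.coe_submonoidClass_iff.1 hζ
  set η : E := ⟨ζ, hζE⟩ with hη'
  let f := hη.autToPow K
  have hspec : ∀ g : E ≃ₐ[K] E, η ^ ((f g : (ZMod (2 ^ m))ˣ) : ZMod (2 ^ m)).val = g η :=
    hη.autToPow_spec K
  have hval : ∀ (j : ℤ) (x : ZMod (2 ^ m)), (j : ZMod (2 ^ m)) = x → η ^ x.val = η ^ j := by
    intro j x hx
    rw [← zpow_natCast]
    have : ((x.val : ℤ) : ZMod (2 ^ m)) = (j : ZMod (2 ^ m)) := by simp [hx]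
    rw [ZMod.intCast_eq_intCast_iff_dvd_sub] at this
    obtain ⟨c, hc⟩ := this
    have h0 : η ≠ 0 := hη.ne_zero hne.ne
    have h1 : η ^ ((2 ^ m : ℕ) : ℤ) = 1 := by rw [zpow_natCast, hη.pow_eq_one]
    rw [show j = x.val + ((2 ^ m : ℕ) : ℤ) * c by linarith, zpow_add₀ h0, zpow_mul, h1, one_zpow,
      mul_one]
  have hneg : -1 ∈ f.range := by
    refine ⟨(conjAlgEquiv K hK).restrictNormal E, ?_⟩
    have h1 : (conjAlgEquiv K hK).restrictNormal E η = η⁻¹ := by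
      refine Subtype.ext ?_
      have h2 := AlgEquiv.restrictNormal_commutes (conjAlgEquiv K hK) E η
      exact h2.trans (conj_eq_inv_of_pow_eq_one hne.ne hζ.pow_eq_one)
    rw [← hspec] at h1
    have h3 : η ^ (-1 : ZMod (2 ^ m)).val = η⁻¹ := by
      rw [hval (-1) (-1) (by simp), zpow_neg_one]
    refine Units.ext (ZMod.val_injective _ (hη.pow_inj (ZMod.val_lt _) (ZMod.val_lt _) ?_))
    rw [h1, Units.val_neg, Units.val_one, h3]
  have hu : ∀ u ∈ f.range, (u : ZMod (2 ^ m)) ≠ 1 + 2 ^ (m - 1) := by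
    rintro _ ⟨g, rfl⟩ hg
    have h1 : g (η ^ 2) = η ^ 2 := by
      rw [map_pow, ← hspec, hval (1 + 2 ^ (m - 1)) _ (by rw [hg]; simp), ← zpow_natCast,
        ← zpow_mul, show ((1 + 2 ^ (m - 1) : ℤ) * (2 : ℕ)) = (2 : ℕ) + ((2 ^ m : ℕ) : ℤ) by
          push_cast
          rw [add_mul, ← pow_succ, Nat.sub_add_cancel (by omega)]; ring,
        zpow_add₀ (hη.ne_zero hne.ne), zpow_natCast, zpow_natCast, hη.pow_eq_one, mul_one]
    have h2 : g η = η := by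
      let A : IntermediateField K E := IntermediateField.fixedField (Subgroup.zpowers g)
      have h3 : η ^ 2 ∈ A := by
        intro ⟨x, hx⟩
        have : Subgroup.zpowers g ≤ MulAction.stabilizer (E ≃ₐ[K] E) (η ^ 2) :=
          (Subgroup.zpowers_le).2 h1
        exact this hx
      have h4 : IntermediateField.adjoin K {ζ ^ 2} ≤ IntermediateField.lift A :=
        IntermediateField.adjoin_le_iff.2 (Set.singleton_subset_iff.2
          ((IntermediateField.mem_lift (η ^ 2)).2 h3))
      have h5 : η ∈ A := (IntermediateField.mem_lift η).1 (h4 hmem)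
      exact h5 ⟨g, Subgroup.mem_zpowers g⟩
    have h6 : η ^ (1 : ZMod (2 ^ m)).val = η := by rw [hval 1 1 (by simp), zpow_one]
    have h7 : ((f g : (ZMod (2 ^ m))ˣ) : ZMod (2 ^ m)) = 1 := by
      refine ZMod.val_injective _ (hη.pow_inj (ZMod.val_lt _) (ZMod.val_lt _) ?_)
      rw [hspec, h2, h6]
    rw [h7] at hg
    have h8 : (2 : ZMod (2 ^ m)) ^ (m - 1) = 0 := by linear_combination -hg
    have h9 : ((2 ^ (m - 1) : ℕ) : ZMod (2 ^ m)) = 0 := by simpa using h8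
    rw [ZMod.natCast_eq_zero_iff, Nat.pow_dvd_pow_iff_le_right (by norm_num)] at h9
    omega
  rw [← IsGalois.card_aut_eq_finrank]
  have hinj : Function.Injective f := hη.autToPow_injective K
  have hle : Nat.card (E ≃ₐ[K] E) ≤ Nat.card ({1, -1} : Set (ZMod (2 ^ m))ˣ) :=
    Nat.card_le_card_of_injective
      (fun g => ⟨f g, eq_one_or_eq_neg_one_of_mem hm hneg hu ⟨g, rfl⟩⟩)
      fun g h hgh => hinj (congrArg Subtype.val hgh)
  exact hle.trans (by
    rw [Nat.card_coe_set_eq]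
    exact (Set.ncard_insert_le _ _).trans (by simp))

theorem I_mem_cyclo {n : ℕ} (hn : 4 ∣ n) (hn0 : n ≠ 0) : Complex.I ∈ cyclo n := by
  obtain ⟨c, rfl⟩ := hn
  refine mem_cyclo_of_pow_eq_one hn0 ?_
  rw [pow_mul, Complex.I_pow_four, one_pow]

/-- For a real subfield of a `2`-power cyclotomic field, `t(K, 2) = 2` unless `m(K, 2) = 1`. -/
theorem schurT_of_real {K : IntermediateField ℚ ℂ} [FiniteDimensional ℚ K] (hK : K ≤ cycloInf 2)
    (hreal : ∀ x ∈ K, conj x = x) :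
    (schurM K 2 = 1 ∧ schurT K 2 = 1) ∨ (2 ≤ schurM K 2 ∧ schurT K 2 = 2) := by
  have hle := le_cyclo_schurM two_ne_zero K hK
  have hT : schurT K 2 = K.relfinrank (cyclo (2 ^ schurM K 2)) := by
    unfold schurT
    rw [inf_eq_left.2 hle]
  have hspec := (schurM_spec K (l := 2) two_ne_zero).1
  have hfin := finrank_cyclo (2 ^ schurM K 2) (by positivity)
  rcases Nat.lt_or_ge 1 (schurM K 2) with hm | hm
  · right
    refine ⟨hm, ?_⟩
    set m := schurM K 2 with hm'
    have hne : (2 ^ m) ≠ 0 := by positivity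
    have hζ := Complex.isPrimitiveRoot_exp (2 ^ m) hne
    set ζ := Complex.exp (2 * Real.pi * Complex.I / ((2 ^ m : ℕ) : ℂ)) with hζ'
    have hζ2 : IsPrimitiveRoot (ζ ^ 2) (2 ^ (m - 1)) :=
      hζ.pow (by positivity) (by rw [← pow_succ', Nat.sub_add_cancel (by omega)])
    have hcm1 := cyclo_eq_adjoin (by positivity) hζ2
    have hcm : cyclo (2 ^ m) = IntermediateField.adjoin ℚ {ζ} := rfl
    -- For `m ≥ 2` the cyclotomic field contains `i`, while `K` is real.
    have hne1 : K.relfinrank (cyclo (2 ^ m)) ≠ 1 := by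
      rw [Ne, IntermediateField.relfinrank_eq_one_iff]
      intro h
      have hI := h (I_mem_cyclo (pow_dvd_pow 2 hm) hne)
      have := hreal _ hI
      rw [Complex.conj_I] at this
      exact Complex.I_ne_zero (self_eq_neg.1 this.symm)
    have hmul := IntermediateField.finrank_bot_mul_relfinrank hle
    rw [hfin] at hmul
    have hpos : K.relfinrank (cyclo (2 ^ m)) ≠ 0 := by
      intro h
      rw [h, mul_zero] at hmul
      exact (Nat.totient_pos.2 (Nat.pos_of_ne_zero hne)).ne hmul
    -- Minimality of `m` enters here. The compositum of `K` and `ℚ(ζ_{2^(m-1)})` sits inside a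
    -- quadratic step; if it were the lower field, `K` would lie in `ℚ(ζ_{2^(m-1)})`. So it is all
    -- of `ℚ(ζ_{2^m})`.
    have hmem : ζ ∈ IntermediateField.adjoin K {ζ ^ 2} := by
      have h1 : cyclo (2 ^ (m - 1)) ≤ K ⊔ cyclo (2 ^ (m - 1)) := le_sup_right
      have h2 : K ⊔ cyclo (2 ^ (m - 1)) ≤ cyclo (2 ^ m) :=
        sup_le hle (cyclo_mono two_ne_zero (Nat.sub_le m 1))
      have h3 := IntermediateField.finrank_bot_mul_relfinrank (h1.trans h2)
      have h4 := IntermediateField.relfinrank_mul_relfinrank h1 h2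
      rw [hfin, finrank_cyclo _ (by positivity), Nat.totient_prime_pow Nat.prime_two (by omega),
        Nat.totient_prime_pow Nat.prime_two (by omega)] at h3
      have h5 : (cyclo (2 ^ (m - 1))).relfinrank (cyclo (2 ^ m)) = 2 := by
        have h6 : 2 ^ (m - 1) = 2 ^ (m - 1 - 1) * 2 := by
          rw [← pow_succ, Nat.sub_add_cancel (by omega)]
        refine Nat.eq_of_mul_eq_mul_left (show 0 < 2 ^ (m - 1 - 1) by positivity) ?_
        rw [← h6]
        simpa using h3
      rw [h5] at h4
      rcases (Nat.dvd_prime Nat.prime_two).1 (Dvd.intro _ h4) with h6 | h6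
      · rw [IntermediateField.relfinrank_eq_one_iff] at h6
        have := schurM_le_of_le_cyclo two_ne_zero (by omega) (le_sup_left.trans h6)
        omega
      · rw [h6] at h4
        have h7 : (K ⊔ cyclo (2 ^ (m - 1))).relfinrank (cyclo (2 ^ m)) = 1 := by omega
        rw [IntermediateField.relfinrank_eq_one_iff] at h7
        have h8 : K ⊔ cyclo (2 ^ (m - 1)) ≤
            (IntermediateField.adjoin K {ζ ^ 2}).restrictScalars ℚ := by
          refine sup_le (fun x hx => ?_) ?_
          · exact IntermediateField.algebraMap_mem (IntermediateField.adjoin K {ζ ^ 2}) ⟨x, hx⟩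
          · rw [hcm1]
            exact IntermediateField.adjoin_le_iff.2 (Set.singleton_subset_iff.2
              (IntermediateField.mem_adjoin_simple_self K (ζ ^ 2)))
        exact h8 (h7 (IntermediateField.mem_adjoin_simple_self ℚ ζ))
    have h2 : K.relfinrank (cyclo (2 ^ m)) ≤ 2 := by
      rw [IntermediateField.relfinrank_eq_finrank_of_le hle]
      have h3 : IntermediateField.extendScalars hle = IntermediateField.adjoin K {ζ} :=
        IntermediateField.extendScalars_adjoin hle
      rw [h3]
      exact finrank_adjoin_le_two hreal hm hζ hmem
    omega
  · left
    have hm1 : schurM K 2 = 1 := by omega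
    refine ⟨hm1, ?_⟩
    have hmul := IntermediateField.finrank_bot_mul_relfinrank hle
    rw [hfin, hm1] at hmul
    rw [pow_one, Nat.totient_two] at hmul
    rw [hT, hm1, pow_one]
    exact Nat.eq_one_of_mul_eq_one_left hmul

end RealSubfields

/-! ### Complex conjugation as Frobenius. -/

section Frobenius

/-- If `p ≡ -1` modulo `2 ^ M`, then complex conjugation is the Frobenius at `p` on the integers
of `ℚ(ζ_{2^M})`. -/
theorem exists_conj_sub_pow_eq {M p : ℕ} (hp : p.Prime) (hM : 2 ^ M ∣ p + 1) {x : ℂ}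
    (hx : x ∈ cyclo (2 ^ M)) (hint : IsIntegral ℤ x) :
    ∃ y : ℂ, IsIntegral ℤ y ∧ conj x - x ^ p = p * y := by
  have hne : (2 ^ M) ≠ 0 := by positivity
  have : NeZero (2 ^ M) := ⟨hne⟩
  have hζ := Complex.isPrimitiveRoot_exp (2 ^ M) hne
  set ζ := Complex.exp (2 * Real.pi * Complex.I / ((2 ^ M : ℕ) : ℂ)) with hζ'
  have hζmem : ζ ∈ cyclo (2 ^ M) := IntermediateField.mem_adjoin_simple_self ℚ _
  have hη : IsPrimitiveRoot (⟨ζ, hζmem⟩ : cyclo (2 ^ M)) (2 ^ M) :=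
    IsPrimitiveRoot.coe_submonoidClass_iff.1 hζ
  have hcl := IsCyclotomicExtension.Rat.isIntegralClosure_adjoin_singleton_of_prime_pow hη
  have hxL : IsIntegral ℤ (⟨x, hx⟩ : cyclo (2 ^ M)) :=
    (isIntegral_algHom_iff (cyclo (2 ^ M)).val.toRingHom.toIntAlgHom
      Subtype.val_injective).1 hint
  obtain ⟨⟨z, hz⟩, hzx⟩ := hcl.isIntegral_iff.1 hxL
  have hzx' : z = (⟨x, hx⟩ : cyclo (2 ^ M)) := hzx
  subst hzx'
  have hζint : IsIntegral ℤ ζ := hζ.isIntegral (Nat.pos_of_ne_zero hne)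
  have hcint : ∀ {a : ℂ}, IsIntegral ℤ a → IsIntegral ℤ (conj a) := fun {a} ha =>
    ha.map (Complex.conjAe.toAlgHom.restrictScalars ℤ)
  -- The ring of integers is `ℤ[ζ]`, and the congruence `conj w ≡ w^p` mod `p` is stable under sums
  -- and products. On `ζ` it says `ζ^p = ζ⁻¹`; on integers it is Fermat's theorem. Integrality of
  -- `w` is carried along to bound the quotients.
  have key : ∀ w : cyclo (2 ^ M), w ∈ Algebra.adjoin ℤ {(⟨ζ, hζmem⟩ : cyclo (2 ^ M))} →
      IsIntegral ℤ (w : ℂ) ∧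
        ∃ y : ℂ, IsIntegral ℤ y ∧ conj (w : ℂ) - (w : ℂ) ^ p = p * y := by
    intro w hw
    induction hw using Algebra.adjoin_induction with
    | mem w hw =>
      rw [Set.mem_singleton_iff] at hw
      subst hw
      refine ⟨hζint, 0, isIntegral_zero, ?_⟩
      obtain ⟨c, hc⟩ := hM
      have h1 : ζ ^ p * ζ = 1 := by rw [← pow_succ, hc, pow_mul, hζ.pow_eq_one, one_pow]
      have h2 : conj ζ = ζ⁻¹ := conj_eq_inv_of_pow_eq_one hne hζ.pow_eq_one
      change conj ζ - ζ ^ p = _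
      rw [h2, eq_inv_of_mul_eq_one_left h1, sub_self, mul_zero]
    | algebraMap r =>
      have hr : ((algebraMap ℤ (cyclo (2 ^ M)) r : cyclo (2 ^ M)) : ℂ) = (r : ℂ) := by simp
      rw [hr]
      refine ⟨isIntegral_algebraMap (R := ℤ) (x := r), ?_⟩
      have : Fact p.Prime := ⟨hp⟩
      have h1 : ((r - r ^ p : ℤ) : ZMod p) = 0 := by
        push_cast
        rw [ZMod.pow_card, sub_self]
      obtain ⟨c, hc⟩ := (ZMod.intCast_zmod_eq_zero_iff_dvd _ _).1 h1
      refine ⟨c, isIntegral_algebraMap (R := ℤ) (x := c), ?_⟩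
      rw [map_intCast]
      exact_mod_cast hc
    | add a b _ _ ha hb =>
      obtain ⟨ha, y, hy, hya⟩ := ha
      obtain ⟨hb, z, hz, hzb⟩ := hb
      obtain ⟨r, hr⟩ := exists_add_pow_prime_eq hp (⟨a, ha⟩ : integralClosure ℤ ℂ) ⟨b, hb⟩
      have hr' : ((a : ℂ) + b) ^ p = (a : ℂ) ^ p + (b : ℂ) ^ p + p * a * b * r := by
        simpa using congrArg (Subtype.val) hr
      refine ⟨ha.add hb, y + z - a * b * r, (hy.add hz).sub ((ha.mul hb).mul r.2), ?_⟩
      change conj ((a : ℂ) + b) - ((a : ℂ) + b) ^ p = _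
      rw [map_add, hr']
      linear_combination hya + hzb
    | mul a b _ _ ha hb =>
      obtain ⟨ha, y, hy, hya⟩ := ha
      obtain ⟨hb, z, hz, hzb⟩ := hb
      refine ⟨ha.mul hb, y * conj (b : ℂ) + (a : ℂ) ^ p * z,
        (hy.mul (hcint hb)).add ((ha.pow p).mul hz), ?_⟩
      change conj ((a : ℂ) * b) - ((a : ℂ) * b) ^ p = _
      rw [map_mul, mul_pow]
      linear_combination conj (b : ℂ) * hya + (a : ℂ) ^ p * hzb
  exact (key _ hz).2

/-- The inclusion of the ring of integers of a subfield of `ℂ` into `ℂ`. -/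
noncomputable def intToComplex (K : IntermediateField ℚ ℂ) : 𝓞 K →+* ℂ :=
  (algebraMap K ℂ).comp (algebraMap (𝓞 K) K)

theorem intToComplex_injective (K : IntermediateField ℚ ℂ) :
    Function.Injective (intToComplex K) := fun _ _ h =>
  NumberField.RingOfIntegers.ext (Subtype.ext h)

theorem intToComplex_conjInt {K : IntermediateField ℚ ℂ} (hc : ∀ x ∈ K, conj x ∈ K) (x : 𝓞 K) :
    intToComplex K (conjInt K hc x) = conj (intToComplex K x) := rfl

theorem exists_intToComplex_eq {K : IntermediateField ℚ ℂ} {y : ℂ} (hyK : y ∈ K)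
    (hy : IsIntegral ℤ y) : ∃ Y : 𝓞 K, intToComplex K Y = y :=
  have hyint : IsIntegral ℤ (⟨y, hyK⟩ : K) :=
    (isIntegral_algHom_iff K.val.toRingHom.toIntAlgHom Subtype.val_injective).1 hy
  ⟨⟨⟨y, hyK⟩, hyint⟩, rfl⟩

/-- The quotient `(conj x - x^p)/p` lies in `K` and is integral, so the congruence descends from the
algebraic integers to `𝓞 K`. -/
theorem exists_conjInt_eq {K : IntermediateField ℚ ℂ} (hc : ∀ x ∈ K, conj x ∈ K)
    {M p : ℕ} (hp : p.Prime) (hM : 2 ^ M ∣ p + 1) (hK : K ≤ cyclo (2 ^ M)) (x : 𝓞 K) :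
    ∃ y : 𝓞 K, conjInt K hc x = x ^ p + p * y := by
  have hx : IsIntegral ℤ ((x : K) : ℂ) := x.2.map K.val.toRingHom.toIntAlgHom
  obtain ⟨y, hy, hxy⟩ := exists_conj_sub_pow_eq hp hM (hK (x : K).2) hx
  have hp0 : (p : ℂ) ≠ 0 := Nat.cast_ne_zero.2 hp.ne_zero
  have hyK : y ∈ K := by
    have h1 : y = (conj ((x : K) : ℂ) - ((x : K) : ℂ) ^ p) / p := by
      rw [hxy, mul_div_cancel_left₀ _ hp0]
    rw [h1]
    exact div_mem (sub_mem (hc _ (x : K).2) (pow_mem (x : K).2 p)) (natCast_mem K p)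
  obtain ⟨Y, rfl⟩ := exists_intToComplex_eq hyK hy
  refine ⟨Y, intToComplex_injective K ?_⟩
  rw [intToComplex_conjInt, map_add, map_mul, map_pow, map_natCast]
  exact sub_eq_iff_eq_add'.1 hxy

end Frobenius

/-! ### Identification of the residue field and the combined bound. -/

section FiniteFields

theorem card_le_of_forall_pow_eq {k : Type*} [Field k] [Fintype k] {N : ℕ} (hN : 2 ≤ N)
    (h : ∀ x : k, x ^ N = x) : Fintype.card k ≤ N := by
  classical
  obtain ⟨g, hg⟩ := IsCyclic.exists_generator (α := kˣ)
  have h1 : g ^ (N - 1) = 1 := by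
    have h2 : g ^ (N - 1) * g = 1 * g := by
      rw [← pow_succ, Nat.sub_add_cancel (by omega), one_mul]
      exact Units.ext (by simpa using h g)
    exact mul_right_cancel h2
  have h3 := Nat.le_of_dvd (by omega) (orderOf_dvd_of_pow_eq_one h1)
  rw [orderOf_eq_card_of_forall_mem_zpowers hg, Nat.card_eq_fintype_card,
    Fintype.card_units] at h3
  omega

/-- The bounds on the isometry groups of all nondegenerate hermitian and skew-hermitian forms over
a finite field whose involution is the `p`-th power map. -/
theorem padicValNat_isoGroup_le {k : Type*} [Field k] [Finite k] {θ : k →+* k} {p M : ℕ}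
    (hp : p.Prime) (hM : 2 ≤ M) (hpM : padicValNat 2 (p + 1) = M) (hpk : (p : k) = 0)
    (hθ : ∀ x, θ x = x ^ p) (hθ2 : ∀ x, θ (θ x) = x) {V : Type*} [AddCommGroup V] [Module k V]
    [Finite V] (β : V →ₗ[k] V →ₛₗ[θ] k) (hs : β.SeparatingLeft)
    (hβ : IsHermitianForm β ∨ IsSkewHermitianForm β) {n : ℕ} (hn : Module.finrank k V = n) :
    ((∀ x, θ x = x) → padicValNat 2 (Nat.card (isoGroup β)) ≤
      (n - n / 2) + M * (n / 2) + padicValNat 2 (n / 2).factorial) ∧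
    ((∃ x, θ x ≠ x) → padicValNat 2 (Nat.card (isoGroup β)) ≤
      M * n + padicValNat 2 n.factorial) := by
  have := Fintype.ofFinite k
  have : Fact p.Prime := ⟨hp⟩
  have hchar : CharP k p := (CharP.ringChar_of_prime_eq_zero hp hpk) ▸ ringChar.charP k
  obtain ⟨r, -, hr⟩ := FiniteField.card k p
  have h4 := mod_four_eq_three hM hpM
  have h2 : (2 : k) ≠ 0 := by
    intro h
    have h1 : ((2 : ℕ) : k) = 0 := by exact_mod_cast h
    rw [CharP.cast_eq_zero_iff k p] at h1
    have := Nat.le_of_dvd (by norm_num) h1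
    have := hp.two_le
    omega
  have hr0 : (r : ℕ) ≠ 0 := r.ne_zero
  constructor
  · intro hid
    -- A trivial `θ` gives `x^p = x` on all of `k`.
    have hcard : Fintype.card k = p := by
      have h1 := card_le_of_forall_pow_eq hp.two_le fun x => (hθ x).symm.trans (hid x)
      exact le_antisymm h1 (hr ▸ Nat.le_self_pow hr0 p)
    rw [← hcard] at hpM
    rcases hβ with hβ | hβ
    · exact padicValNat_isoGroup_symmetric_le hM hpM h2 hid β hβ hs hn
    · exact (padicValNat_isoGroup_alternating_le hM hpM h2 hid n β hβ hs hn).2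
  · rintro ⟨x, hx⟩
    -- `θ² = 1` gives `x^(p²) = x`, hence at most `p²` elements; with only `p` elements `θ` would be
    -- trivial.
    have hcard : Fintype.card k = p ^ 2 := by
      have h1 : Fintype.card k ≤ p ^ 2 :=
        card_le_of_forall_pow_eq (hp.two_le.trans (Nat.le_self_pow two_ne_zero p)) fun x => by
          rw [sq, pow_mul, ← hθ, ← hθ, hθ2]
      have h3 : (r : ℕ) ≤ 2 := (Nat.pow_le_pow_iff_right hp.one_lt).1 (hr ▸ h1)
      have h5 : (r : ℕ) ≠ 1 := by
        intro h
        apply hx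
        rw [hθ]
        nth_rw 2 [← FiniteField.pow_card x]
        rw [hr, h, pow_one]
      rw [hr, show (r : ℕ) = 2 by omega]
    rcases hβ with hβ | hβ
    · exact padicValNat_isoGroup_hermitian_le hM hpM hcard h2 hθ n β hβ hs hn
    · obtain ⟨s, hs0, hsβ⟩ := hβ.exists_isHermitianForm_smul hθ2 hx
      rw [← isoGroup_smul β hs0]
      exact padicValNat_isoGroup_hermitian_le hM hpM hcard h2 hθ n _ hsβ
        (separatingLeft_smul hs hs0) hn

end FiniteFields

/-! ### Supply of rational primes and of primes above them. -/

section Primes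

/-- Dirichlet for the class of `2^M - 1` modulo `2^(M+1)`; the extra power of 2 in the modulus makes
the valuation exact. -/
theorem infinite_primes_padicValNat (M : ℕ) (hM : 1 ≤ M) :
    {p : ℕ | p.Prime ∧ padicValNat 2 (p + 1) = M}.Infinite := by
  have h2 : 1 ≤ 2 ^ M := Nat.one_le_two_pow
  have hcop : (2 ^ M - 1).Coprime (2 ^ (M + 1)) := by
    refine Nat.Coprime.pow_right _ (Nat.coprime_two_right.2 ?_)
    exact Nat.Even.sub_odd h2 ((Nat.even_pow' (by omega)).2 even_two) odd_one
  refine (Nat.infinite_setOfPred_prime_and_modEq (by positivity) hcop).mono fun p hp => ⟨hp.1, ?_⟩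
  have h3 : p + 1 ≡ 2 ^ M [MOD 2 ^ (M + 1)] := by
    have := hp.2.add_right 1
    rwa [Nat.sub_add_cancel h2] at this
  have h4 : 2 ^ M ∣ p + 1 :=
    (h3.dvd_iff (pow_dvd_pow 2 (Nat.le_succ M))).2 dvd_rfl
  have h5 : ¬ 2 ^ (M + 1) ∣ p + 1 := by
    rw [h3.dvd_iff dvd_rfl, Nat.pow_dvd_pow_iff_le_right (by norm_num)]
    omega
  rw [padicValNat_dvd_iff_le (by omega)] at h4 h5
  omega

theorem exists_isMaximal_natCast_mem (K : Type*) [Field K] [NumberField K] {p : ℕ} (hp : p.Prime) :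
    ∃ 𝔭 : Ideal (𝓞 K), 𝔭.IsMaximal ∧ (p : 𝓞 K) ∈ 𝔭 := by
  have hmax : (Ideal.span {(p : ℤ)}).IsMaximal :=
    PrincipalIdealRing.isMaximal_of_irreducible (Nat.prime_iff_prime_int.1 hp).irreducible
  obtain ⟨𝔭, h𝔭, hlies⟩ :=
    Ideal.exists_maximal_ideal_liesOver_of_isIntegral (S := 𝓞 K) (Ideal.span {(p : ℤ)})
  refine ⟨𝔭, h𝔭, ?_⟩
  have h1 : (p : ℤ) ∈ 𝔭.under ℤ := by
    rw [← hlies.over]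
    exact Ideal.mem_span_singleton_self _
  simpa [Ideal.mem_comap] using h1

/-- Makes the choice of a prime above `p` injective in `p`, and keeps 2 out of it. -/
theorem Ideal.IsPrime.eq_of_natCast_mem {R : Type*} [CommRing R] {𝔭 : Ideal R} (h𝔭 : 𝔭.IsPrime)
    {p q : ℕ} (hp : p.Prime) (hq : q.Prime) (hpm : (p : R) ∈ 𝔭) (hqm : (q : R) ∈ 𝔭) : p = q := by
  by_contra hne
  have hcop : IsCoprime (p : ℤ) q := Nat.isCoprime_iff_coprime.2 ((Nat.coprime_primes hp hq).2 hne)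
  obtain ⟨a, b, hab⟩ := hcop
  apply h𝔭.ne_top
  rw [Ideal.eq_top_iff_one]
  have h1 : (a : R) * p + b * q = 1 := by exact_mod_cast congrArg (Int.cast : ℤ → R) hab
  rw [← h1]
  exact 𝔭.add_mem (𝔭.mul_mem_left _ hpm) (𝔭.mul_mem_left _ hqm)

end Primes

/-! ### Comparison with the Schur bound and the main theorem. -/

theorem conj_eq_self_of_mem_cyclo_two {x : ℂ} (hx : x ∈ cyclo 2) : conj x = x := by
  have h : cyclo 2 = ⊥ := by
    rw [cyclo_eq_adjoin two_ne_zero (IsPrimitiveRoot.neg_one 0 (by norm_num)),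
      IntermediateField.adjoin_simple_eq_bot_iff]
    exact neg_mem (one_mem _)
  rw [h, IntermediateField.mem_bot] at hx
  obtain ⟨r, rfl⟩ := hx
  simp

/-- The hypotheses on `K` reduce the Schur bound to the bounds for the isometry groups. -/
theorem exists_le_cyclo_and_bounds (K : IntermediateField ℚ ℂ) [FiniteDimensional ℚ K]
    (hK : K ≤ cycloInf 2)
    (hT : ¬ ((K : Set ℂ) ⊆ Set.range ((↑) : ℝ → ℂ)) → schurT K 2 = 1) :
    ∃ M, 2 ≤ M ∧ K ≤ cyclo (2 ^ M) ∧
      (((∀ x ∈ K, conj x = x) ∧ ∀ n, (n - n / 2) + M * (n / 2) + padicValNat 2 (n / 2).factorial ≤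
        padicValNat 2 (schurS n K)) ∨
      (Complex.I ∈ K ∧ ∀ n, M * n + padicValNat 2 n.factorial ≤ padicValNat 2 (schurS n K))) := by
  have hle := le_cyclo_schurM two_ne_zero K hK
  by_cases hreal : (K : Set ℂ) ⊆ Set.range ((↑) : ℝ → ℂ)
  · have hconj : ∀ x ∈ K, conj x = x := by
      intro x hx
      obtain ⟨r, rfl⟩ := hreal hx
      exact Complex.conj_ofReal r
    rcases schurT_of_real hK hconj with ⟨hm, ht⟩ | ⟨hm, ht⟩
    -- Here `K = ℚ`. The group bounds need `M ≥ 2`, so `M = 2` replaces `m = 1`. Nothing is lost: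
    -- `v₂(n!) = ⌊n/2⌋ + v₂(⌊n/2⌋!)` turns the bound into `n + v₂(n!)`.
    · refine ⟨2, le_rfl, hle.trans (cyclo_mono two_ne_zero (by omega)), Or.inl ⟨hconj, fun n => ?_⟩⟩
      have h := le_padicValNat_schurS n K
      rw [hm, ht, Nat.div_one, ← padicValNat_mul_div_factorial n, padicValNat_factorial_mul] at h
      omega
    · refine ⟨schurM K 2, hm, hle, Or.inl ⟨hconj, fun n => ?_⟩⟩
      have h := le_padicValNat_schurS n K
      rwa [ht] at h
  · have ht := hT hreal
    -- `t(K,2) = 1` forces `K` to be the full cyclotomic field; being non-real, it has `m ≥ 2` and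
    -- contains `i`.
    have hcyc : cyclo (2 ^ schurM K 2) ≤ K := by
      have h := IntermediateField.relfinrank_eq_one_iff.1 ht
      exact h.trans inf_le_left
    have hm : 2 ≤ schurM K 2 := by
      by_contra! hlt
      have hm1 : schurM K 2 = 1 := le_antisymm (by omega) (schurM_spec K two_ne_zero).1
      rw [hm1, pow_one] at hle
      refine hreal fun x hx => ⟨x.re, ?_⟩
      exact Complex.conj_eq_iff_re.1 (conj_eq_self_of_mem_cyclo_two (hle hx))
    refine ⟨schurM K 2, hm, hle, Or.inr
      ⟨hcyc (I_mem_cyclo (pow_dvd_pow 2 hm) (by positivity)), fun n => ?_⟩⟩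
    have h := le_padicValNat_schurS n K
    rw [ht, Nat.div_one] at h
    omega

theorem mainTheorem10 (K : IntermediateField ℚ ℂ) [NumberField K]
    (hK : K ≤ cycloInf 2) :
    IsGalois ℚ K ∧
    ∃ hc : ∀ x ∈ K, conj x ∈ K,
      (¬ ((K : Set ℂ) ⊆ Set.range ((↑) : ℝ → ℂ)) → schurT K 2 = 1) →
      {𝔭 : Ideal (𝓞 K) | 𝔭.IsPrime ∧ 𝔭 ≠ ⊥ ∧ (2 : 𝓞 K) ∉ 𝔭 ∧
        ∃ hs : 𝔭 = 𝔭.map (conjInt K hc : 𝓞 K →+* 𝓞 K),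
          ∀ (n : ℕ)
            (β : (Fin n → 𝓞 K ⧸ 𝔭) →ₗ[𝓞 K ⧸ 𝔭]
              (Fin n → 𝓞 K ⧸ 𝔭) →ₛₗ[residueAut (conjInt K hc) 𝔭 hs] 𝓞 K ⧸ 𝔭),
            β.SeparatingLeft → (IsHermitianForm β ∨ IsSkewHermitianForm β) →
              pPart 2 (Nat.card (isoGroup β)) ∣ pPart 2 (schurS n K)}.Infinite := by
  have hfd : FiniteDimensional ℚ K := NumberField.to_finiteDimensional
  have hgal : IsGalois ℚ K :=
    isGalois_of_le_cyclo (pow_ne_zero _ two_ne_zero) (le_cyclo_schurM two_ne_zero K hK)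
  refine ⟨hgal, fun x hx => conj_mem_of_normal K hgal.to_normal hx, fun hT => ?_⟩
  set hc : ∀ x ∈ K, conj x ∈ K := fun x hx => conj_mem_of_normal K hgal.to_normal hx
  obtain ⟨M, hM, hKM, hbound⟩ := exists_le_cyclo_and_bounds K hK hT
  choose! P hPmax hPmem using fun (p : ℕ) (hp : p.Prime) => exists_isMaximal_natCast_mem K hp
  refine Set.infinite_of_injOn_mapsTo (f := P) ?_ ?_ (infinite_primes_padicValNat M (by omega))
  · intro p hp q hq hpq
    exact (hPmax p hp.1).isPrime.eq_of_natCast_mem hp.1 hq.1 (hPmem p hp.1)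
      (hpq ▸ hPmem q hq.1)
  · rintro p ⟨hp, hpM⟩
    have hmax := hPmax p hp
    have hmem := hPmem p hp
    generalize P p = 𝔭 at hmax hmem
    have hdvd : 2 ^ M ∣ p + 1 := hpM ▸ pow_padicValNat_dvd
    have hfrob := exists_conjInt_eq hc hp hdvd hKM
    have h2 : (2 : 𝓞 K) ∉ 𝔭 := by
      intro h
      have := hmax.isPrime.eq_of_natCast_mem hp Nat.prime_two hmem (by exact_mod_cast h)
      have := mod_four_eq_three hM hpM
      omega
    have hmaps : ∀ x ∈ 𝔭, conjInt K hc x ∈ 𝔭 := by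
      intro x hx
      obtain ⟨y, hy⟩ := hfrob x
      rw [hy]
      exact 𝔭.add_mem (Ideal.pow_mem_of_mem _ hx _ hp.pos) (𝔭.mul_mem_right _ hmem)
    have hinv : ∀ x, conjInt K hc (conjInt K hc x) = x := fun x =>
      intToComplex_injective K (Complex.conj_conj _)
    have hs : 𝔭 = 𝔭.map (conjInt K hc : 𝓞 K →+* 𝓞 K) := by
      refine le_antisymm (fun x hx => ?_) (Ideal.map_le_iff_le_comap.2 hmaps)
      rw [← hinv x]
      exact Ideal.mem_map_of_mem (conjInt K hc : 𝓞 K →+* 𝓞 K) (hmaps x hx)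
    have hne : 𝔭 ≠ ⊥ := by
      rintro rfl
      rw [Ideal.mem_bot] at hmem
      exact hp.ne_zero (by exact_mod_cast hmem)
    refine ⟨hmax.isPrime, hne, h2, hs, fun n β hβs hβ => ?_⟩
    have hfin : Finite (𝓞 K ⧸ 𝔭) := inferInstance
    have hmk : ∀ x : 𝓞 K, residueAut (conjInt K hc) 𝔭 hs (Ideal.Quotient.mk 𝔭 x) =
        Ideal.Quotient.mk 𝔭 (conjInt K hc x) := fun x => rfl
    have hpk : (p : 𝓞 K ⧸ 𝔭) = 0 := by
      rw [← map_natCast (Ideal.Quotient.mk 𝔭)]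
      exact Ideal.Quotient.eq_zero_iff_mem.2 hmem
    have hθ : ∀ x, residueAut (conjInt K hc) 𝔭 hs x = x ^ p := by
      intro x
      obtain ⟨x, rfl⟩ := Ideal.Quotient.mk_surjective x
      obtain ⟨y, hy⟩ := hfrob x
      rw [hmk, hy, map_add, map_mul, map_natCast, hpk, zero_mul, add_zero, map_pow]
    have hθ2 : ∀ x, residueAut (conjInt K hc) 𝔭 hs (residueAut (conjInt K hc) 𝔭 hs x) = x := by
      intro x
      obtain ⟨x, rfl⟩ := Ideal.Quotient.mk_surjective x
      rw [hmk, hmk, hinv]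
    let _ : Field (𝓞 K ⧸ 𝔭) := Ideal.Quotient.field 𝔭
    have hmain := padicValNat_isoGroup_le hp hM hpM hpk hθ hθ2 β hβs hβ
      (Module.finrank_fin_fun (𝓞 K ⧸ 𝔭))
    refine pow_dvd_pow 2 ?_
    rcases hbound with ⟨hreal, hb⟩ | ⟨hI, hb⟩
    · refine (hmain.1 fun x => ?_).trans (hb n)
      obtain ⟨x, rfl⟩ := Ideal.Quotient.mk_surjective x
      rw [hmk]
      congr 1
      exact intToComplex_injective K (hreal _ (x : K).2)
    · refine (hmain.2 ?_).trans (hb n)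
      obtain ⟨i, hi⟩ := exists_intToComplex_eq hI Complex.isIntegral_int_I
      have hci : conjInt K hc i = -i := by
        apply intToComplex_injective K
        rw [intToComplex_conjInt, map_neg, hi, Complex.conj_I]
      have hii : i * i = -1 := by
        apply intToComplex_injective K
        rw [map_mul, map_neg, map_one, hi, Complex.I_mul_I]
      -- The class of `i` is moved by `θ`: otherwise `-2i ∈ 𝔭`, and multiplying by `i` gives `2 ∈
      -- 𝔭`.
      refine ⟨Ideal.Quotient.mk 𝔭 i, fun h => h2 ?_⟩
      rw [hmk, hci, Ideal.Quotient.eq] at h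
      have h3 := 𝔭.mul_mem_left i h
      have h4 : i * (-i - i) = 2 := by linear_combination -2 * hii
      rwa [h4] at h3
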